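/- **Proposition (extension of M-polyfold construction functors).** M-polyfolds (paracompact Hausdorff spaces with an atlas of charts onto sc-smooth retracts in partial quadrants of sc-Banach spaces), sc-smooth maps, sub-M-polyfolds and their induced M-polyfold structures are understood in the sense of Hofer, Wysocki and Zehnder. Let $\mathcal N$ be the category whose objects are the integers $N\ge 0$ and whose morphisms $N\to L$ are the smooth maps $\mathbb R^N\to\mathbb R^L$. An *M-polyfold construction functor* over $\mathcal N$ is a covariant functor $X$ from $\mathcal N$ to the category $\mathbf{MPoly}$ of M-polyfolds and sc-smooth maps, together with an assignment, for each $N$, of a subset $\mathrm{im}(u)\subset\mathbb R^N$ to each $u\in X(N)$, such that 1. for every open $U\subset\mathbb R^N$ the set $\{u\in X(N):\mathrm{im}(u)\subset U\}$ is open in $X(N)$; 2. $\mathrm{im}(X(f)(u))=f(\mathrm{im}(u))$ for every morphism $f:N\to L$ and $u\in X(N)$; 3. if $f,g:N\to L$ are morphisms, $u\in X(N)$ and $f|_{\mathrm{im}(u)}=g|_{\mathrm{im}(u)}$, then $X(f)(u)=X(g)(u)$. Let $\mathcal P$ be the category of smooth manifolds without boundary (Hausdorff, paracompact) and smooth maps.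 For a proper smooth embedding $\phi:M\to\mathbb R^N$ put $X(\phi)=\{u\in X(N):\mathrm{im}(u)\subset\phi(M)\}$. Then for every M-polyfold construction functor $X:\mathcal N\to\mathbf{MPoly}$ there exist a functor $\widetilde X:\mathcal P\to\mathbf{MPoly}$ and, for every nonempty connected $M\in\mathcal P$ and every proper smooth embedding $\phi:M\to\mathbb R^N$, a map $\phi_\sharp:\widetilde X(M)\to X(N)$, such that the following hold. * (a) For every nonempty connected $M$ and every proper smooth embedding $\phi:M\to\mathbb R^N$, the set $X(\phi)$ is a sub-M-polyfold of $X(N)$, and $\phi_\sharp$ is an sc-diffeomorphism of $\widetilde X(M)$ onto $X(\phi)$ with its induced M-polyfold structure. * (b) If $M,W$ are nonempty connected manifolds, $f:M\to W$ is smooth, $\phi:M\to\mathbb R^N$ and $\psi:W\to\mathbb R^L$ are proper smooth embeddings and $F:\mathbb R^N\to\mathbb R^L$ is any smooth map with $F\circ\phi=\psi\circ f$, then $\psi_\sharp\circ\widetilde X(f)=X(F)\circ\phi_\sharp$. * (c) For every $M\in\mathcal P$ with connected components $M_\lambda$ and inclusions $i_\lambda:M_\lambda\to M$, each $\widetilde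 X(i_\lambda)$ is an sc-diffeomorphism of $\widetilde X(M_\lambda)$ onto an open subset of $\widetilde X(M)$, and $\widetilde X(M)$ is the disjoint union of these open subsets. * (d) There is a natural sc-diffeomorphism $\kappa_N:X(N)\to\widetilde X(\mathbb R^N)$: one has $(\mathrm{id}_{\mathbb R^N})_\sharp\circ\kappa_N=\mathrm{id}_{X(N)}$ for all $N$, and $\kappa_L\circ X(f)=\widetilde X(f)\circ\kappa_N$ for every smooth $f:\mathbb R^N\to\mathbb R^L$. -/

import Mathlib

open Set Filter Topology Asymptotics
open scoped Manifold ContDiff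

universe u v

noncomputable section

namespace Polyfold

/-! ### Sc-Banach spaces -/

/-- An sc-Banach space.  The nested subspaces `E_{i+1} ⊆ E_i` are given as Banach spaces `level i`
together with injective continuous linear inclusions `step i : E_{i+1} → E_i`, which are compact.
A point of `E_∞ = ⋂ E_j` is a compatible sequence of points `y j ∈ E_j`, and `E_∞` is dense in
every `E_i`. -/
structure ScBanach where
  level : ℕ → Type u
  [normed : ∀ i, NormedAddCommGroup (level i)]
  [space : ∀ i, NormedSpace ℝ (level i)]
  [complete : ∀ i, CompleteSpace (level i)]
  step : ∀ i, level (i + 1) →L[ℝ] level i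
  step_injective : ∀ i, Function.Injective (step i)
  step_compact : ∀ i, IsCompactOperator (step i)
  dense_infty : ∀ i, Dense
    {x : level i | ∃ y : ∀ j, level j, (∀ j, step j (y (j + 1)) = y j) ∧ y i = x}

attribute [instance] ScBanach.normed ScBanach.space ScBanach.complete

namespace ScBanach

/-- The inclusion `E_i → E_0`. -/
def incl (E : ScBanach.{u}) : ∀ i, E.level i →L[ℝ] E.level 0
  | 0 => ContinuousLinearMap.id ℝ (E.level 0)
  | i + 1 => (E.incl i).comp (E.step i)

/-- A product of two compact operators is compact. -/
theorem isCompactOperator_prodMap {A B C D : Type*}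
    [NormedAddCommGroup A] [NormedSpace ℝ A] [NormedAddCommGroup B] [NormedSpace ℝ B]
    [NormedAddCommGroup C] [NormedSpace ℝ C] [NormedAddCommGroup D] [NormedSpace ℝ D]
    (f : A →L[ℝ] B) (g : C →L[ℝ] D) (hf : IsCompactOperator f) (hg : IsCompactOperator g) :
    IsCompactOperator (f.prodMap g) := by
  obtain ⟨K, hK, hK'⟩ := hf
  obtain ⟨L, hL, hL'⟩ := hg
  refine ⟨K ×ˢ L, hK.prod hL, ?_⟩
  have h := prod_mem_nhds hK' hL'
  exact mem_of_superset h (fun x hx => hx)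

/-- The sc-direct sum, `(E ⊕ F)_i = E_i ⊕ F_i`. -/
def prod (E : ScBanach.{u}) (F : ScBanach.{v}) : ScBanach.{max u v} where
  level i := E.level i × F.level i
  step i := (E.step i).prodMap (F.step i)
  step_injective i := (E.step_injective i).prodMap (F.step_injective i)
  step_compact i := isCompactOperator_prodMap _ _ (E.step_compact i) (F.step_compact i)
  dense_infty i := by
    refine ((E.dense_infty i).prod (F.dense_infty i)).mono ?_
    rintro ⟨a, b⟩ ⟨⟨y, hy, rfl⟩, ⟨z, hz, rfl⟩⟩
    exact ⟨fun j => (y j, z j), fun j => Prod.ext (hy j) (hz j), rfl⟩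

/-- The space `E^1` obtained from `E` by raising the index by one, `(E^1)_i = E_{1+i}`. -/
def raise (E : ScBanach.{u}) : ScBanach.{u} where
  level i := E.level (i + 1)
  step i := E.step (i + 1)
  step_injective i := E.step_injective (i + 1)
  step_compact i := E.step_compact (i + 1)
  dense_infty i := by
    refine (E.dense_infty (i + 1)).mono ?_
    rintro x ⟨y, hy, rfl⟩
    exact ⟨fun j => y (j + 1), fun j => hy (j + 1), rfl⟩

/-- The tangent space `TE = E^1 ⊕ E`, with `(TE)_i = E_{1+i} ⊕ E_i`. -/
def tangent (E : ScBanach.{u}) : ScBanach.{u} := E.raise.prod E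

/-- `ℝⁿ` with its (unique) constant sc-structure. -/
def euclidean (n : ℕ) : ScBanach.{0} where
  level _ := EuclideanSpace ℝ (Fin n)
  step _ := ContinuousLinearMap.id ℝ _
  step_injective _ := fun _ _ h => h
  step_compact _ := ⟨Metric.closedBall 0 1, isCompact_closedBall _ _,
    Metric.closedBall_mem_nhds _ one_pos⟩
  dense_infty i := by
    refine dense_univ.mono ?_
    intro x _
    exact ⟨fun _ => x, fun _ => rfl, rfl⟩

end ScBanach

/-- An sc-isomorphism `E → F`: a linear bijection which restricts to a topological isomorphism
`E_i → F_i` on every level. -/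
structure ScIso (E : ScBanach.{u}) (F : ScBanach.{v}) where
  equiv : ∀ i, E.level i ≃L[ℝ] F.level i
  equiv_step : ∀ i x, F.step i (equiv (i + 1) x) = equiv i (E.step i x)

/-- A partial quadrant `C ⊆ E`: the image of `[0,∞)ⁿ ⊕ W` under an sc-isomorphism
`ℝⁿ ⊕ W → E`.  (Such a set is automatically closed and convex.) -/
def IsPartialQuadrant (E : ScBanach.{u}) (C : Set (E.level 0)) : Prop :=
  ∃ (n : ℕ) (W : ScBanach.{u}) (T : ScIso ((ScBanach.euclidean n).prod W) E),
    C = T.equiv 0 '' {p : EuclideanSpace ℝ (Fin n) × W.level 0 | ∀ i, 0 ≤ p.1 i}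

/-- `U` is a relatively open subset of `C`. -/
def IsRelOpen {A : Type*} [TopologicalSpace A] (C U : Set A) : Prop :=
  ∃ V : Set A, IsOpen V ∧ U = C ∩ V

/-! ### Sc-calculus

Maps `U → F` are represented by functions `E_0 → F_0`, of which only the values on `U` matter. -/

/-- `f : U → F` is sc-continuous: it maps `U_i = U ∩ E_i` to `F_i`, continuously, for all `i`. -/
def ScContinuous (E : ScBanach.{u}) (F : ScBanach.{v}) (U : Set (E.level 0))
    (f : E.level 0 → F.level 0) : Prop :=
  ∀ i, ∃ g : E.level i → F.level i,
    (∀ x, E.incl i x ∈ U → F.incl i (g x) = f (E.incl i x)) ∧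
    ContinuousOn g {x | E.incl i x ∈ U}

/-- `f : U → F` is of class `sc^k`.  Here `f₁` is `f` regarded as a map `U_1 → F_1`, `D x` is the
linearization `Df(x) : E_0 → F_0` at `x ∈ U_1`, and `(x, h) ↦ (f₁ x, D x h)` is the tangent map
`Tf : TU → TF`, where `TU = U_1 ⊕ E_0`. -/
def ScClass : ℕ → ∀ (E : ScBanach.{u}) (F : ScBanach.{v}) (_ : Set (E.level 0))
    (_ : E.level 0 → F.level 0), Prop
  | 0, E, F, U, f => ScContinuous E F U f
  | k + 1, E, F, U, f => ScContinuous E F U f ∧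
      ∃ (f₁ : E.level 1 → F.level 1) (D : E.level 1 → (E.level 0 →L[ℝ] F.level 0)),
        (∀ x, E.step 0 x ∈ U → F.step 0 (f₁ x) = f (E.step 0 x)) ∧
        (∀ x, E.step 0 x ∈ U →
          (fun h : E.level 1 =>
            f (E.step 0 (x + h)) - f (E.step 0 x) - D x (E.step 0 h))
              =o[𝓝[{h | E.step 0 (x + h) ∈ U}] 0] (fun h => h)) ∧
        ScClass k E.tangent F.tangent
          {p : E.level 1 × E.level 0 | E.step 0 p.1 ∈ U}
          (fun p : E.level 1 × E.level 0 => ((f₁ p.1, D p.1 p.2) : F.level 1 × F.level 0))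

/-- `f : U → F` is sc-smooth. -/
def ScSmooth (E : ScBanach.{u}) (F : ScBanach.{v}) (U : Set (E.level 0))
    (f : E.level 0 → F.level 0) : Prop :=
  ∀ k, ScClass k E F U f

/-! ### Sc-smooth models -/

/-- `r : U → U` is an sc-smooth retraction on a relatively open subset `U` of `C ⊆ E`. -/
structure IsScRetraction (E : ScBanach.{u}) (C U : Set (E.level 0))
    (r : E.level 0 → E.level 0) : Prop where
  relOpen : IsRelOpen C U
  mapsTo : MapsTo r U U
  idem : ∀ x ∈ U, r (r x) = r x
  smooth : ScSmooth E E U r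

/-- `(O, C, E)` is an sc-smooth model. -/
def IsScModel (E : ScBanach.{u}) (C O : Set (E.level 0)) : Prop :=
  IsPartialQuadrant E C ∧ ∃ U r, IsScRetraction E C U r ∧ r '' U = O

/-- A map `f` from the sc-smooth model `(O, C, E)` to a model in `F` is sc-smooth: `f ∘ r` is
sc-smooth on `U` for a suitable sc-smooth retraction `r : U → U` with `r(U) = O`. -/
def ModelSmooth (E : ScBanach.{u}) (C O : Set (E.level 0)) (F : ScBanach.{v})
    (f : E.level 0 → F.level 0) : Prop :=
  ∃ U r, IsScRetraction E C U r ∧ r '' U = O ∧ ScSmooth E F U (f ∘ r)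

/-! ### M-polyfolds -/

/-- An M-polyfold chart on `X`: a homeomorphism from an open subset `source` of `X` onto
`O = target`, where `(O, C, E)` is an sc-smooth model. -/
structure Chart (X : Type u) [TopologicalSpace X] where
  E : ScBanach.{u}
  C : Set (E.level 0)
  toPartialEquiv : PartialEquiv X (E.level 0)
  isModel : IsScModel E C toPartialEquiv.target
  open_source : IsOpen toPartialEquiv.source
  continuousOn_toFun : ContinuousOn toPartialEquiv toPartialEquiv.source
  continuousOn_invFun : ContinuousOn toPartialEquiv.symm toPartialEquiv.target

/-- The local representative `φ' ∘ f ∘ φ⁻¹ : φ(S ∩ dom φ ∩ f⁻¹(dom φ')) → O'` of a map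
`f : X → Y`, restricted to the open set `S`, is sc-smooth. -/
def Chart.RepSmooth {X : Type u} [TopologicalSpace X] {Y : Type v} [TopologicalSpace Y]
    (c : Chart X) (d : Chart Y) (f : X → Y) (S : Set X) : Prop :=
  ModelSmooth c.E c.C
    (c.toPartialEquiv.target ∩
      c.toPartialEquiv.symm ⁻¹' (S ∩ f ⁻¹' d.toPartialEquiv.source))
    d.E (d.toPartialEquiv ∘ f ∘ c.toPartialEquiv.symm)

/-- An M-polyfold: a paracompact Hausdorff space with an sc-smooth atlas.  (The equivalence class
of atlases is given by a representative; the notions below depend on the class only.) -/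
structure MPolyfold where
  carrier : Type u
  [top : TopologicalSpace carrier]
  [t2 : T2Space carrier]
  [paracompact : ParacompactSpace carrier]
  atlas : Set (Chart carrier)
  cover : ∀ x, ∃ c ∈ atlas, x ∈ c.toPartialEquiv.source
  compatible : ∀ c ∈ atlas, ∀ d ∈ atlas, c.RepSmooth d id univ

instance : CoeSort MPolyfold.{u} (Type u) := ⟨MPolyfold.carrier⟩

attribute [instance] MPolyfold.top MPolyfold.t2 MPolyfold.paracompact

/-- The map `f`, restricted to the open set `S ⊆ X`, is sc-smooth as a map `S → Y`. -/
def MSmoothOn {X : MPolyfold.{u}} {Y : MPolyfold.{v}} (f : X → Y) (S : Set X) : Prop :=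
  ContinuousOn f S ∧ ∀ c ∈ X.atlas, ∀ d ∈ Y.atlas, c.RepSmooth d f S

/-- `f : X → Y` is an sc-smooth map between M-polyfolds. -/
def MSmooth {X : MPolyfold.{u}} {Y : MPolyfold.{v}} (f : X → Y) : Prop :=
  MSmoothOn f univ

/-- `f : X → Y` is an sc-diffeomorphism. -/
def IsScDiffeo {X : MPolyfold.{u}} {Y : MPolyfold.{v}} (f : X → Y) : Prop :=
  MSmooth f ∧ ∃ g : Y → X, MSmooth g ∧ Function.LeftInverse g f ∧ Function.RightInverse g f

/-- `r : U → U` is an sc-smooth map on the open set `U ⊆ X` with `r ∘ r = r`, `r(U) = U ∩ A`. -/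
structure IsLocalRetraction {X : MPolyfold.{u}} (A U : Set X) (r : X → X) : Prop where
  isOpen : IsOpen U
  smooth : MSmoothOn r U
  idem : ∀ x ∈ U, r (r x) = r x
  image : r '' U = U ∩ A

/-- `A` is a sub-M-polyfold of `X`. -/
def IsSubMPolyfold {X : MPolyfold.{u}} (A : Set X) : Prop :=
  ∀ a ∈ A, ∃ U r, a ∈ U ∧ IsLocalRetraction A U r

/-- `g : Y → X` is an sc-diffeomorphism of `Y` onto the sub-M-polyfold `A` of `X`, where `A` carries
the induced M-polyfold structure.  That structure is the one for which the inclusion `j : A → X`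
and all the maps `j⁻¹ ∘ r : U → A`, with `r` a local sc-smooth retraction onto `U ∩ A`, are
sc-smooth; below, `s` is `j⁻¹ ∘ r` transported to `Y`. -/
structure IsScDiffeoOnto {Y : MPolyfold.{v}} {X : MPolyfold.{u}} (g : Y → X) (A : Set X) :
    Prop where
  sub : IsSubMPolyfold A
  smooth : MSmooth g
  injective : Function.Injective g
  range_eq : range g = A
  smooth_inv : ∀ U r, IsLocalRetraction A U r →
    ∀ s : X → Y, (∀ x ∈ U, g (s x) = r x) → MSmoothOn s U

/-! ### M-polyfold construction functors -/

/-- `ℝ^N` -/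
abbrev RSpace (N : ℕ) : Type := EuclideanSpace ℝ (Fin N)

/-- An M-polyfold construction functor over the category `𝒩` whose objects are the natural numbers
and whose morphisms `N → L` are the smooth maps `ℝ^N → ℝ^L`. -/
structure ConstructionFunctor where
  obj : ℕ → MPolyfold.{u}
  map : ∀ {N L : ℕ} (f : RSpace N → RSpace L), ContDiff ℝ ∞ f → obj N → obj L
  map_smooth : ∀ {N L : ℕ} (f : RSpace N → RSpace L) (hf : ContDiff ℝ ∞ f), MSmooth (map f hf)
  map_id : ∀ (N : ℕ) (u : obj N), map (id : RSpace N → RSpace N) contDiff_id u = u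
  map_comp : ∀ {N L K : ℕ} (g : RSpace L → RSpace K) (f : RSpace N → RSpace L)
    (hg : ContDiff ℝ ∞ g) (hf : ContDiff ℝ ∞ f) (u : obj N),
    map (g ∘ f) (hg.comp hf) u = map g hg (map f hf u)
  /-- the image `im(u) ⊆ ℝ^N` of a point `u ∈ X(N)` -/
  im : ∀ {N : ℕ}, obj N → Set (RSpace N)
  isOpen_im_subset : ∀ {N : ℕ} (U : Set (RSpace N)), IsOpen U → IsOpen {u : obj N | im u ⊆ U}
  im_map : ∀ {N L : ℕ} (f : RSpace N → RSpace L) (hf : ContDiff ℝ ∞ f) (u : obj N),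
    im (map f hf u) = f '' im u
  map_congr : ∀ {N L : ℕ} (f g : RSpace N → RSpace L) (hf : ContDiff ℝ ∞ f)
    (hg : ContDiff ℝ ∞ g) (u : obj N), EqOn f g (im u) → map f hf u = map g hg u

/-! ### Smooth manifolds -/

/-- An object of the category `𝒫`: a smooth manifold without boundary, Hausdorff and paracompact. -/
structure SmoothMfd where
  dim : ℕ
  carrier : Type
  [top : TopologicalSpace carrier]
  [t2 : T2Space carrier]
  [paracompact : ParacompactSpace carrier]
  [charted : ChartedSpace (EuclideanSpace ℝ (Fin dim)) carrier]
  [isManifold : IsManifold (𝓡 dim) ∞ carrier]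

instance : CoeSort SmoothMfd Type := ⟨SmoothMfd.carrier⟩

attribute [instance] SmoothMfd.top SmoothMfd.t2 SmoothMfd.paracompact SmoothMfd.charted
  SmoothMfd.isManifold

namespace SmoothMfd

/-- A map between smooth manifolds is smooth. -/
def Smooth {M W : SmoothMfd} (f : M → W) : Prop := ContMDiff (𝓡 M.dim) (𝓡 W.dim) ∞ f

theorem smooth_id (M : SmoothMfd) : Smooth (id : M → M) := contMDiff_id

theorem Smooth.comp {M W Z : SmoothMfd} {g : W → Z} {f : M → W} (hg : Smooth g) (hf : Smooth f) :
    Smooth (g ∘ f) := ContMDiff.comp hg hf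

/-- `ℝ^N` as a smooth manifold. -/
def euclidean (N : ℕ) : SmoothMfd where
  dim := N
  carrier := RSpace N

theorem smooth_euclidean {N L : ℕ} {f : RSpace N → RSpace L} (hf : ContDiff ℝ ∞ f) :
    Smooth (M := euclidean N) (W := euclidean L) f := hf.contMDiff

theorem isClopen_component (M : SmoothMfd) (c : ConnectedComponents M) :
    IsClopen ((ConnectedComponents.mk : M → ConnectedComponents M) ⁻¹' {c}) := by
  obtain ⟨x, rfl⟩ := ConnectedComponents.surjective_coe c
  have : LocallyConnectedSpace M :=
    ChartedSpace.locallyConnectedSpace (EuclideanSpace ℝ (Fin M.dim)) M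
  rw [connectedComponents_preimage_singleton]
  exact ⟨isClosed_connectedComponent, isOpen_connectedComponent⟩

/-- A connected component of `M`, as an open subset. -/
def componentOpens (M : SmoothMfd) (c : ConnectedComponents M) : TopologicalSpace.Opens M :=
  ⟨(ConnectedComponents.mk : M → ConnectedComponents M) ⁻¹' {c}, (M.isClopen_component c).isOpen⟩

/-- A connected component of `M`, as a smooth manifold. -/
def component (M : SmoothMfd) (c : ConnectedComponents M) : SmoothMfd where
  dim := M.dim
  carrier := M.componentOpens c
  top := inferInstanceAs (TopologicalSpace (M.componentOpens c))
  t2 := inferInstanceAs (T2Space {x : M // x ∈ M.componentOpens c})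
  paracompact := (M.isClopen_component c).isClosed.isClosedEmbedding_subtypeVal.paracompactSpace

/-- The inclusion of a connected component. -/
def componentIncl (M : SmoothMfd) (c : ConnectedComponents M) : M.component c → M :=
  fun x => (show M.componentOpens c from x).1

theorem smooth_componentIncl (M : SmoothMfd) (c : ConnectedComponents M) :
    Smooth (M.componentIncl c) :=
  contMDiff_subtype_val (I := 𝓡 M.dim) (n := ∞) (U := M.componentOpens c)

end SmoothMfd

/-- A proper smooth embedding `M → ℝ^N`. -/
structure ProperEmbedding (M : SmoothMfd) (N : ℕ) where
  toFun : M → RSpace N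
  isSmoothEmbedding : Manifold.IsSmoothEmbedding (𝓡 M.dim) (𝓡 N) ∞ toFun
  isProper : IsProperMap toFun

instance (M : SmoothMfd) (N : ℕ) : CoeFun (ProperEmbedding M N) (fun _ => M → RSpace N) :=
  ⟨ProperEmbedding.toFun⟩

/-- The identity `ℝ^N → ℝ^N` as a proper smooth embedding. -/
def ProperEmbedding.id (N : ℕ) : ProperEmbedding (SmoothMfd.euclidean N) N where
  toFun := fun x => x
  isSmoothEmbedding := Manifold.IsSmoothEmbedding.id
  isProper := isProperMap_id

instance (N : ℕ) : ConnectedSpace (SmoothMfd.euclidean N) :=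
  inferInstanceAs (ConnectedSpace (EuclideanSpace ℝ (Fin N)))

/-- A functor from the category `𝒫` of smooth manifolds without boundary and smooth maps to the
category of M-polyfolds and sc-smooth maps. -/
structure ManifoldFunctor where
  obj : SmoothMfd → MPolyfold.{u}
  map : ∀ {M W : SmoothMfd} (f : M → W), SmoothMfd.Smooth f → obj M → obj W
  map_smooth : ∀ {M W : SmoothMfd} (f : M → W) (hf : SmoothMfd.Smooth f), MSmooth (map f hf)
  map_id : ∀ (M : SmoothMfd) (u : obj M), map (id : M → M) M.smooth_id u = u
  map_comp : ∀ {M W Z : SmoothMfd} (g : W → Z) (f : M → W)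
    (hg : SmoothMfd.Smooth g) (hf : SmoothMfd.Smooth f) (u : obj M),
    map (g ∘ f) (hg.comp hf) u = map g hg (map f hf u)

/-- The set `X(φ) ⊆ X(N)` of all `u` with `im(u) ⊆ φ(M)`. -/
def ConstructionFunctor.over (X : ConstructionFunctor.{u}) {M : SmoothMfd} {N : ℕ}
    (φ : ProperEmbedding M N) : Set (X.obj N) :=
  {u | X.im u ⊆ range φ}

end Polyfold

end

open Polyfold

-- A connected manifold `M` has a proper embedding `φ` into some `ℝ^N`, and there is a smooth map `R
-- : ℝ^N → ℝ^N` which fixes `φ(M)` and sends a neighbourhood `V` of `φ(M)` into `φ(M)`. By axioms 2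
-- and 3, `X(R)` is a retraction of the open set `{u | im u ⊆ V}` onto `X(φ)`, so `X(φ)` is a
-- sub-M-polyfold (`exists_isLocalRetraction`). It is also closed, as the set where two continuous
-- maps into a Hausdorff space agree (`isClosed_over`), hence paracompact.
--
-- A smooth `f : M → W` extends to a smooth map `F` of the ambient spaces, and by axiom 3 the
-- restriction of `X(F)` to `X(φ)` depends on `f` alone. One chosen embedding for each connected
-- manifold therefore gives a functor (`space`, `spaceMap`). For any other embedding, extending the
-- change of embedding in both directions yields mutually inverse sc-smooth maps
-- (`isScDiffeoOnto_sharp`). A general manifold is sent to the disjoint union over its components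
-- (`extObj`); the empty manifold gives the empty M-polyfold.
--
-- Most of the work goes into two inputs. In sc-calculus these are the chain rule `ScClass.comp`,
-- which rests on compactness of `E_1 → E_0`, and the locality `ScClass.of_local`; together they
-- give composition of sc-smooth maps (`MSmoothOn.comp`), while conjugating a retraction by charts
-- gives the induced structure `toMPolyfold`. In differential topology they are the smooth
-- nearest-point projection `exists_smooth_retraction` and the Whitney theorem
-- `exists_properEmbedding`, where slabs of an exhaustion function are embedded in `ℝ^(2n+1)` by
-- generic projection and then glued.

universe w

namespace Polyfold

/-! ### Levels of sc-Banach spaces -/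

namespace ScBanach

theorem incl_injective (E : ScBanach.{u}) : ∀ i, Function.Injective (E.incl i)
  | 0 => fun _ _ h => h
  | i + 1 => fun _ _ h => E.step_injective i (E.incl_injective i h)

theorem step_incl_raise (E : ScBanach.{u}) :
    ∀ i (x : E.level (i + 1)), E.step 0 (E.raise.incl i x) = E.incl (i + 1) x
  | 0, _ => rfl
  | i + 1, x => E.step_incl_raise i (E.step (i + 1) x)

theorem incl_prod (E : ScBanach.{u}) (F : ScBanach.{v}) :
    ∀ i (p : E.level i × F.level i), (E.prod F).incl i p = (E.incl i p.1, F.incl i p.2)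
  | 0, _ => rfl
  | i + 1, p => E.incl_prod F i (E.step i p.1, F.step i p.2)

theorem step_incl_tangent (E : ScBanach.{u}) (i : ℕ) (p : E.level (i + 1) × E.level i) :
    E.step 0 (E.tangent.incl i p : E.level 1 × E.level 0).1 = E.incl (i + 1) p.1 := by
  have h : E.tangent.incl i p = (E.raise.incl i p.1, E.incl i p.2) := E.raise.incl_prod E i p
  rw [h]
  exact E.step_incl_raise i p.1

/-- The domain `TU = U_1 ⊕ E_0` of the tangent map. -/
def tangentSet (E : ScBanach.{u}) (U : Set (E.level 0)) : Set (E.tangent.level 0) :=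
  {p : E.level 1 × E.level 0 | E.step 0 p.1 ∈ U}

theorem denseRange_step (E : ScBanach.{u}) : DenseRange (E.step 0) := by
  refine (E.dense_infty 0).mono ?_
  rintro x ⟨y, hy, rfl⟩
  exact ⟨y 1, hy 0⟩

end ScBanach

open ScBanach

variable {E : ScBanach.{u}} {F : ScBanach.{v}} {G : ScBanach.{w}}

/-! ### Restriction and congruence -/

theorem ScContinuous.mono_congr {U V : Set (E.level 0)} {f g : E.level 0 → F.level 0}
    (h : ScContinuous E F U f) (hVU : V ⊆ U) (hfg : EqOn f g V) : ScContinuous E F V g := by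
  intro i
  obtain ⟨k, hk, hk'⟩ := h i
  exact ⟨k, fun x hx => (hk x (hVU hx)).trans (hfg hx), hk'.mono fun x hx => hVU hx⟩

theorem ScClass.mono_congr {k : ℕ} {U V : Set (E.level 0)} {f g : E.level 0 → F.level 0}
    (h : ScClass k E F U f) (hVU : V ⊆ U) (hfg : EqOn f g V) : ScClass k E F V g := by
  induction k generalizing E F with
  | zero => exact ScContinuous.mono_congr h hVU hfg
  | succ k ih =>
    obtain ⟨h0, f₁, D, h1, h2, h3⟩ := h
    refine ⟨h0.mono_congr hVU hfg, f₁, D, fun x hx => (h1 x (hVU hx)).trans (hfg hx),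
      fun x hx => ?_, ih h3 (fun p hp => hVU hp) (fun p _ => rfl)⟩
    refine ((h2 x (hVU hx)).mono (nhdsWithin_mono _ fun h hh => hVU hh)).congr' ?_ .rfl
    filter_upwards [self_mem_nhdsWithin] with h hh
    rw [hfg hh, hfg hx]

theorem ScSmooth.mono_congr {U V : Set (E.level 0)} {f g : E.level 0 → F.level 0}
    (h : ScSmooth E F U f) (hVU : V ⊆ U) (hfg : EqOn f g V) : ScSmooth E F V g :=
  fun k => (h k).mono_congr hVU hfg

theorem ScSmooth.mono {U V : Set (E.level 0)} {f : E.level 0 → F.level 0}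
    (h : ScSmooth E F U f) (hVU : V ⊆ U) : ScSmooth E F V f :=
  h.mono_congr hVU fun _ _ => rfl

theorem ScClass.scContinuous {k : ℕ} {U : Set (E.level 0)} {f : E.level 0 → F.level 0}
    (h : ScClass k E F U f) : ScContinuous E F U f := by
  cases k with
  | zero => exact h
  | succ k => exact h.1

theorem ScContinuous.continuousOn {U : Set (E.level 0)} {f : E.level 0 → F.level 0}
    (h : ScContinuous E F U f) : ContinuousOn f U := by
  obtain ⟨g, hg, hg'⟩ := h 0
  exact hg'.congr fun x hx => (hg x hx).symm

theorem ScSmooth.continuousOn {U : Set (E.level 0)} {f : E.level 0 → F.level 0}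
    (h : ScSmooth E F U f) : ContinuousOn f U :=
  ScContinuous.continuousOn (h 0)

/-! ### The chain rule -/

theorem ScContinuous.comp {U : Set (E.level 0)} {V : Set (F.level 0)}
    {f : E.level 0 → F.level 0} {g : F.level 0 → G.level 0}
    (hg : ScContinuous F G V g) (hf : ScContinuous E F U f) (hUV : MapsTo f U V) :
    ScContinuous E G U (g ∘ f) := by
  intro i
  obtain ⟨fi, hfi, hfi'⟩ := hf i
  obtain ⟨gi, hgi, hgi'⟩ := hg i
  have hm : MapsTo fi {x | E.incl i x ∈ U} {y | F.incl i y ∈ V} := by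
    intro x hx
    change F.incl i (fi x) ∈ V
    rw [hfi x hx]
    exact hUV hx
  refine ⟨gi ∘ fi, fun x hx => ?_, hgi'.comp hfi' hm⟩
  change G.incl i (gi (fi x)) = g (f _)
  rw [hgi _ (hm hx), hfi x hx]

/-- A subset of the form `C ∩ V` with `C` convex and `V` open. -/
def IsLocallyConvex (E : ScBanach.{u}) (U : Set (E.level 0)) : Prop :=
  ∃ C : Set (E.level 0), Convex ℝ C ∧ IsRelOpen C U

theorem IsLocallyConvex.tangentSet {U : Set (E.level 0)} (h : IsLocallyConvex E U) :
    IsLocallyConvex E.tangent (E.tangentSet U) := by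
  obtain ⟨C, hC, V, hV, rfl⟩ := h
  let T : E.level 1 × E.level 0 →L[ℝ] E.level 0 := (E.step 0).comp (.fst ℝ _ _)
  exact ⟨T ⁻¹' C, hC.linear_preimage T.toLinearMap, T ⁻¹' V, hV.preimage T.continuous, rfl⟩

/-- The error of the linear approximation along a segment is controlled by the variation of the
derivative in the direction of the segment. -/
theorem norm_sub_sub_le_of_segment {A B : Type*} [NormedAddCommGroup A] [NormedSpace ℝ A]
    [NormedAddCommGroup B] [NormedSpace ℝ B] {S : Set A} {g : A → B} {g' : A → A →L[ℝ] B}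
    (hg : ∀ y ∈ S, HasFDerivWithinAt g (g' y) S y) {y k : A} {c : ℝ}
    (hS : ∀ t ∈ Icc (0 : ℝ) 1, y + t • k ∈ S)
    (hc : ∀ t ∈ Icc (0 : ℝ) 1, ‖g' (y + t • k) k - g' y k‖ ≤ c) :
    ‖g (y + k) - g y - g' y k‖ ≤ c := by
  have hl : ∀ t : ℝ, HasDerivAt (fun t : ℝ => y + t • k) k t := fun t => by
    simpa using ((hasDerivAt_id t).smul_const k).const_add y
  have hd : ∀ t ∈ Icc (0 : ℝ) 1, HasDerivWithinAt (fun t : ℝ => g (y + t • k) - t • g' y k)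
      (g' (y + t • k) k - g' y k) (Icc 0 1) t := by
    intro t ht
    have h1 := (hg _ (hS t ht)).comp_hasDerivWithinAt t (hl t).hasDerivWithinAt
      (show MapsTo (fun t : ℝ => y + t • k) (Icc 0 1) S from hS)
    have h2 := ((hasDerivAt_id t).smul_const (g' y k)).hasDerivWithinAt (s := Icc (0 : ℝ) 1)
    rw [one_smul] at h2
    exact h1.sub h2
  have := norm_image_sub_le_of_norm_deriv_le_segment' hd (C := c)
    (fun t ht => hc t (Ico_subset_Icc_self ht)) 1 (right_mem_Icc.2 zero_le_one)
  have e : g (y + k) - g y - g' y k = g (y + (1 : ℝ) • k) - (1 : ℝ) • g' y k -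
      (g (y + (0 : ℝ) • k) - (0 : ℝ) • g' y k) := by
    simp only [one_smul, zero_smul, add_zero, sub_zero]; abel
  rw [e]
  simpa using this

/-- This turns the linearization clause of `ScClass` into ordinary calculus: it says that `f ∘
E.step 0` has derivative `(D x).comp (E.step 0)` on level 1. -/
theorem hasFDerivWithinAt_of_isLittleO {A B : Type*} [NormedAddCommGroup A] [NormedSpace ℝ A]
    [NormedAddCommGroup B] [NormedSpace ℝ B] {S : Set A} {g : A → B} {L : A →L[ℝ] B} {x : A} :
    (fun h : A => g (x + h) - g x - L h) =o[𝓝[{h | x + h ∈ S}] 0] (fun h => h) ↔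
      HasFDerivWithinAt g L S x := by
  rw [hasFDerivWithinAt_iff_isLittleO]
  have hm : map (fun h => x + h) (𝓝[{h | x + h ∈ S}] 0) = 𝓝[S] x := by
    have := (Homeomorph.addLeft x).isEmbedding.map_nhdsWithin_eq {h | x + h ∈ S} 0
    have hS : Homeomorph.addLeft x '' {h | x + h ∈ S} = S :=
      (Homeomorph.addLeft x).surjective.image_preimage S
    rw [hS] at this
    simpa using this
  rw [← hm, isLittleO_map]
  simp [Function.comp_def]


/-- With `k h = f₁ (x + h) - f₁ x` and `b h` the linearization error of `f`, the error of `g ∘ f`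
splits into the error of `g` along `k h` plus `D' y (b h)`. The second is `o(h)`. The first is
bounded by the variation of `D' z (k h)` for `z` on the segment from `y` to `y + k h`. Here `D'` is
only jointly continuous, not norm continuous, so uniformity in the direction is needed: on level 0,
`k h / ‖h‖` differs from `D (h / ‖h‖)` by `o(1)`, and the latter lies in the compact set `K`,
because `E_1 → E_0` is compact. -/
theorem isLittleO_comp {U : Set (E.level 0)} {V : Set (F.level 0)} (hV : IsLocallyConvex F V)
    {f : E.level 0 → F.level 0} {g : F.level 0 → G.level 0}
    {f₁ : E.level 1 → F.level 1} {D : E.level 0 →L[ℝ] F.level 0}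
    {D' : F.level 1 → (F.level 0 →L[ℝ] G.level 0)} {x : E.level 1} (hx : E.step 0 x ∈ U)
    (hUV : MapsTo f U V) (hf₁ : ∀ z, E.step 0 z ∈ U → F.step 0 (f₁ z) = f (E.step 0 z))
    (hf₁c : ContinuousOn f₁ {z | E.step 0 z ∈ U})
    (hD : (fun h : E.level 1 => f (E.step 0 (x + h)) - f (E.step 0 x) - D (E.step 0 h))
      =o[𝓝[{h | E.step 0 (x + h) ∈ U}] 0] (fun h => h))
    (hD' : ∀ y, F.step 0 y ∈ V → (fun h : F.level 1 =>
      g (F.step 0 (y + h)) - g (F.step 0 y) - D' y (F.step 0 h))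
        =o[𝓝[{h | F.step 0 (y + h) ∈ V}] 0] (fun h => h))
    (hD'c : ContinuousOn (fun p : F.level 1 × F.level 0 => D' p.1 p.2)
      {p | F.step 0 p.1 ∈ V}) :
    (fun h : E.level 1 =>
      g (f (E.step 0 (x + h))) - g (f (E.step 0 x)) - D' (f₁ x) (D (E.step 0 h)))
        =o[𝓝[{h | E.step 0 (x + h) ∈ U}] 0] (fun h => h) := by
  obtain ⟨C, hC, W, hW, rfl⟩ := hV
  set V₁ : Set (F.level 1) := {y | F.step 0 y ∈ C ∩ W} with hV₁
  set l := 𝓝[{h : E.level 1 | E.step 0 (x + h) ∈ U}] 0 with hl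
  set y := f₁ x with hy
  have hyV : y ∈ V₁ := by
    change F.step 0 (f₁ x) ∈ C ∩ W
    rw [hf₁ x hx]; exact hUV hx
  have hg : ∀ z ∈ V₁, HasFDerivWithinAt (g ∘ F.step 0) ((D' z).comp (F.step 0)) V₁ z :=
    fun z hz => hasFDerivWithinAt_of_isLittleO.1 (hD' z hz)
  set k : E.level 1 → F.level 1 := fun h => f₁ (x + h) - y with hk
  set b : E.level 1 → F.level 0 :=
    fun h => f (E.step 0 (x + h)) - f (E.step 0 x) - D (E.step 0 h) with hb
  have hmem : ∀ᶠ h in l, E.step 0 (x + h) ∈ U := self_mem_nhdsWithin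
  have hkt : Tendsto k l (𝓝 0) := by
    have h1 : Tendsto (fun h : E.level 1 => x + h) l (𝓝[{z | E.step 0 z ∈ U}] x) := by
      refine tendsto_nhdsWithin_iff.2 ⟨?_, hmem⟩
      refine (Continuous.tendsto' (by fun_prop) _ _ (by simp)).mono_left nhdsWithin_le_nhds
    have h2 := ((hf₁c x hx).tendsto.comp h1).sub_const y
    simpa [hy] using h2
  have hsk : ∀ h, E.step 0 (x + h) ∈ U →
      F.step 0 (k h) = f (E.step 0 (x + h)) - f (E.step 0 x) := fun h hh => by
    rw [hk, map_sub, hf₁ _ hh, hy, hf₁ _ hx]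
  have ha : (fun h => g (F.step 0 (y + k h)) - g (F.step 0 y) - D' y (F.step 0 (k h)))
      =o[l] (fun h => h) := by
    rw [isLittleO_iff]
    intro ε hε
    set K : Set (F.level 0) := closure ((fun h => D (E.step 0 h)) '' Metric.closedBall 0 1) with hK
    have hKc : IsCompact K :=
      ((E.step_compact 0).clm_comp D).isCompact_closure_image_closedBall (𝕜₁ := ℝ)
        (f := (D.comp (E.step 0) : E.level 1 →ₗ[ℝ] F.level 0)) 1
    have hN : {p : F.level 1 × F.level 0 | p.1 ∈ V₁ → ‖D' p.1 p.2 - D' y p.2‖ < ε} ∈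
        𝓝 y ×ˢ 𝓝ˢ K := by
      refine hKc.mem_prod_nhdsSet_of_forall fun v _ => ?_
      have hc : ContinuousWithinAt (fun p : F.level 1 × F.level 0 => ‖D' p.1 p.2 - D' y p.2‖)
          {p | F.step 0 p.1 ∈ C ∩ W} (y, v) :=
        ((hD'c (y, v) hyV).sub (by fun_prop)).norm
      have h1 : ∀ᶠ p in 𝓝[{p : F.level 1 × F.level 0 | F.step 0 p.1 ∈ C ∩ W}] (y, v),
          ‖D' p.1 p.2 - D' y p.2‖ < ε := hc.eventually_lt_const (by simpa using hε)
      rw [← nhds_prod_eq]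
      exact eventually_nhdsWithin_iff.1 h1
    obtain ⟨N₁, hN₁, N₂, hN₂, hNN⟩ := mem_prod_iff.1 hN
    obtain ⟨O, hO, hKO, hON⟩ := mem_nhdsSet_iff_exists.1 hN₂
    obtain ⟨δ, hδ, hδO⟩ := hKc.exists_thickening_subset_open hO hKO
    obtain ⟨η, hη, hηN⟩ := Metric.mem_nhds_iff.1 (inter_mem hN₁
      ((hW.preimage (F.step 0).continuous).mem_nhds hyV.2))
    filter_upwards [hmem, hkt (Metric.ball_mem_nhds 0 hη),
      isLittleO_iff.1 hD (half_pos hδ)] with h hhU hhk hhb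
    have hkV : y + k h ∈ V₁ := by
      change F.step 0 (y + k h) ∈ C ∩ W
      rw [map_add, hsk h hhU, hy, hf₁ _ hx, add_sub_cancel]
      exact hUV hhU
    -- Convexity keeps the segment in `C`; the choice of `η` keeps it in `W` and in `N₁`.
    have hseg : ∀ t ∈ Icc (0 : ℝ) 1, y + t • k h ∈ V₁ ∧ y + t • k h ∈ N₁ := by
      intro t ht
      have hball : y + t • k h ∈ Metric.ball y η := by
        rw [mem_ball_iff_norm, add_sub_cancel_left, norm_smul, Real.norm_of_nonneg ht.1]
        have : ‖k h‖ < η := by simpa using hhk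
        nlinarith [ht.1, ht.2, norm_nonneg (k h)]
      refine ⟨⟨?_, (hηN hball).2⟩, (hηN hball).1⟩
      have := hC hyV.1 hkV.1 (sub_nonneg.2 ht.2) ht.1 (sub_add_cancel _ _)
      convert this using 1
      simp only [map_add, map_smul]
      module
    refine norm_sub_sub_le_of_segment (g := g ∘ F.step 0) (g' := fun z => (D' z).comp (F.step 0))
      hg (fun t ht => (hseg t ht).1) fun t ht => ?_
    rcases eq_or_ne h 0 with rfl | hh0
    · simp [hk, hy]
    have hpos : 0 < ‖h‖ := norm_pos_iff.2 hh0
    set v := ‖h‖⁻¹ • F.step 0 (k h) with hv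
    have hvO : v ∈ O := by
      refine hδO (Metric.mem_thickening_iff.2 ⟨D (E.step 0 (‖h‖⁻¹ • h)),
        subset_closure ⟨_, ?_, rfl⟩, ?_⟩)
      · simp [norm_smul, hpos.ne']
      · have : v - D (E.step 0 (‖h‖⁻¹ • h)) = ‖h‖⁻¹ • b h := by
          rw [hv, hsk h hhU, hb, map_smul, map_smul, ← smul_sub]
        rw [dist_eq_norm, this, norm_smul, norm_inv, norm_norm]
        calc ‖h‖⁻¹ * ‖b h‖ ≤ ‖h‖⁻¹ * (δ / 2 * ‖h‖) := by gcongr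
          _ = δ / 2 := by field_simp
          _ < δ := half_lt_self hδ
    have hlt : ‖D' (y + t • k h) v - D' y v‖ < ε :=
      hNN (show (y + t • k h, v) ∈ N₁ ×ˢ N₂ from ⟨(hseg t ht).2, hON hvO⟩) (hseg t ht).1
    have hkv : F.step 0 (k h) = ‖h‖ • v := by
      rw [hv, smul_smul, mul_inv_cancel₀ hpos.ne', one_smul]
    clear_value v
    change ‖D' (y + t • k h) (F.step 0 (k h)) - D' y (F.step 0 (k h))‖ ≤ _
    rw [hkv, map_smul, map_smul, ← smul_sub, norm_smul, norm_norm, mul_comm]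
    gcongr
  have hb' : (fun h => D' y (b h)) =o[l] (fun h => h) :=
    ((D' y).isBigO_comp b l).trans_isLittleO hD
  refine (ha.add hb').congr' ?_ .rfl
  filter_upwards [hmem] with h hh
  have e1 : F.step 0 (y + k h) = f (E.step 0 (x + h)) := by
    rw [map_add, hsk h hh, hy, hf₁ _ hx, add_sub_cancel]
  have e2 : D' y (b h) = D' y (F.step 0 (k h)) - D' y (D (E.step 0 h)) := by
    rw [← (D' y).map_sub, hsk h hh]
  rw [e1, e2, show F.step 0 y = f (E.step 0 x) from hf₁ x hx, sub_add_sub_cancel]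

/-- Induction on `k`: the tangent map of a composition is the composition of the tangent maps, and
`tangentSet` preserves local convexity. -/
theorem ScClass.comp {k : ℕ} {U : Set (E.level 0)} {V : Set (F.level 0)}
    {f : E.level 0 → F.level 0} {g : F.level 0 → G.level 0} (hV : IsLocallyConvex F V)
    (hg : ScClass k F G V g) (hf : ScClass k E F U f) (hUV : MapsTo f U V) :
    ScClass k E G U (g ∘ f) := by
  induction k generalizing E F G with
  | zero => exact ScContinuous.comp hg hf hUV
  | succ k ih =>
    obtain ⟨hf0, f₁, D, hf1, hf2, hf3⟩ := hf
    obtain ⟨hg0, g₁, D', hg1, hg2, hg3⟩ := hg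
    have hm : ∀ x, E.step 0 x ∈ U → F.step 0 (f₁ x) ∈ V := fun x hx => by
      rw [hf1 x hx]; exact hUV hx
    refine ⟨hg0.comp hf0 hUV, g₁ ∘ f₁, fun x => (D' (f₁ x)).comp (D x), fun x hx => ?_,
      fun x hx => ?_, ?_⟩
    · change G.step 0 (g₁ (f₁ x)) = g (f _)
      rw [hg1 _ (hm x hx), hf1 x hx]
    · have hfc : ContinuousOn (fun p : E.level 1 × E.level 0 => ((f₁ p.1, D p.1 p.2) :
          F.level 1 × F.level 0)) {p | E.step 0 p.1 ∈ U} := hf3.scContinuous.continuousOn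
      have hgc : ContinuousOn (fun p : F.level 1 × F.level 0 => ((g₁ p.1, D' p.1 p.2) :
          G.level 1 × G.level 0)) {p | F.step 0 p.1 ∈ V} := hg3.scContinuous.continuousOn
      have hf₁c : ContinuousOn f₁ {z | E.step 0 z ∈ U} :=
        hfc.fst.comp (f := fun z => (z, (0 : E.level 0))) (by fun_prop) fun z hz => hz
      exact isLittleO_comp hV hx hUV hf1 hf₁c (hf2 x hx) hg2 hgc.snd
    · exact ih hV.tangentSet hg3 hf3 fun p hp => hm p.1 hp

theorem ScSmooth.comp {U : Set (E.level 0)} {V : Set (F.level 0)}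
    {f : E.level 0 → F.level 0} {g : F.level 0 → G.level 0} (hV : IsLocallyConvex F V)
    (hg : ScSmooth F G V g) (hf : ScSmooth E F U f) (hUV : MapsTo f U V) :
    ScSmooth E G U (g ∘ f) :=
  fun k => (hg k).comp hV (hf k) hUV

/-! ### Sc-smoothness is a local property -/

/-- Derivatives on `U` are unique, on every level. -/
def IsUniqueDiff (E : ScBanach.{u}) (U : Set (E.level 0)) : Prop :=
  ∀ i, UniqueDiffOn ℝ {x : E.level i | E.incl i x ∈ U}

theorem IsUniqueDiff.inter {U V : Set (E.level 0)} (h : IsUniqueDiff E U) (hV : IsOpen V) :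
    IsUniqueDiff E (U ∩ V) :=
  fun i => (h i).inter (hV.preimage (E.incl i).continuous)

theorem IsUniqueDiff.tangentSet {U : Set (E.level 0)} (h : IsUniqueDiff E U) :
    IsUniqueDiff E.tangent (E.tangentSet U) := by
  intro i
  have : {x : E.tangent.level i | E.tangent.incl i x ∈ E.tangentSet U} =
      {x : E.level (i + 1) | E.incl (i + 1) x ∈ U} ×ˢ (univ : Set (E.level i)) := by
    ext p
    change E.step 0 (E.tangent.incl i p : E.level 1 × E.level 0).1 ∈ U ↔ _
    rw [E.step_incl_tangent i p]
    exact ⟨fun h => ⟨h, trivial⟩, fun h => h.1⟩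
  rw [this]
  exact (h (i + 1)).prod uniqueDiffOn_univ

theorem ScContinuous.of_local {U : Set (E.level 0)} {f : E.level 0 → F.level 0}
    (h : ∀ x ∈ U, ∃ V, IsOpen V ∧ x ∈ V ∧ ScContinuous E F (U ∩ V) f) : ScContinuous E F U f := by
  intro i
  have hex : ∀ x : E.level i, E.incl i x ∈ U → ∃ y, F.incl i y = f (E.incl i x) := by
    intro x hx
    obtain ⟨V, -, hxV, hV⟩ := h _ hx
    obtain ⟨g, hg, -⟩ := hV i
    exact ⟨g x, hg x ⟨hx, hxV⟩⟩
  choose! g hg using hex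
  refine ⟨g, hg, fun x hx => ?_⟩
  obtain ⟨V, hVo, hxV, hV⟩ := h _ hx
  obtain ⟨g', hg', hc⟩ := hV i
  have heq : EqOn g g' {x | E.incl i x ∈ U ∩ V} := fun z hz =>
    F.incl_injective i ((hg z hz.1).trans (hg' z hz).symm)
  have := (hc.congr heq) x ⟨hx, hxV⟩
  exact this.mono_of_mem_nhdsWithin
    (inter_mem_nhdsWithin _ ((hVo.preimage (E.incl i).continuous).mem_nhds hxV))

/-- The local data `f₁` and `D` exist separately on each piece and have to agree on overlaps.
Injectivity of `F.step 0` determines `f₁`; unique differentiability on level 1 determines `D z` on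
the image of `E_1`, and density of that image in `E_0` determines it everywhere. Hence at `z` the
data of the piece chosen for `z` itself may be used. -/
theorem ScClass.of_local {k : ℕ} {U : Set (E.level 0)} {f : E.level 0 → F.level 0}
    (hU : IsUniqueDiff E U)
    (h : ∀ x ∈ U, ∃ V, IsOpen V ∧ x ∈ V ∧ ScClass k E F (U ∩ V) f) : ScClass k E F U f := by
  induction k generalizing E F with
  | zero => exact ScContinuous.of_local h
  | succ k ih =>
    refine ⟨ScContinuous.of_local fun x hx => (h x hx).imp fun V hV => ⟨hV.1, hV.2.1, hV.2.2.1⟩, ?_⟩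
    choose! V hVo hxV h0 f₁ D hf₁ hD hT using h
    have hinter : ∀ x ∈ U, ∀ z, E.step 0 z ∈ U ∩ V x →
        HasFDerivWithinAt (f ∘ E.step 0) ((D x z).comp (E.step 0)) {z | E.step 0 z ∈ U} z := by
      intro x hx z hz
      have : HasFDerivWithinAt (f ∘ E.step 0) ((D x z).comp (E.step 0))
          {z | E.step 0 z ∈ U ∩ V x} z := hasFDerivWithinAt_of_isLittleO.1 (hD x hx z hz)
      refine this.mono_of_mem_nhdsWithin (inter_mem_nhdsWithin _ ?_)
      exact ((hVo x hx).preimage (E.step 0).continuous).mem_nhds hz.2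
    have hU1 : UniqueDiffOn ℝ {z : E.level 1 | E.step 0 z ∈ U} := hU 1
    have hDeq : ∀ x ∈ U, ∀ z, E.step 0 z ∈ U ∩ V x → D (E.step 0 z) z = D x z := by
      intro x hx z hz
      have heq : (D (E.step 0 z) z).comp (E.step 0) = (D x z).comp (E.step 0) :=
        hU1.eq hz.1 (hinter _ hz.1 z ⟨hz.1, hxV _ hz.1⟩) (hinter x hx z hz)
      refine ContinuousLinearMap.ext fun w => ?_
      refine congrFun (E.denseRange_step.equalizer (D _ z).continuous (D x z).continuous ?_) w
      exact funext fun w => DFunLike.congr_fun heq w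
    have hfeq : ∀ x ∈ U, ∀ z, E.step 0 z ∈ U ∩ V x → f₁ (E.step 0 z) z = f₁ x z :=
      fun x hx z hz => F.step_injective 0
        ((hf₁ _ hz.1 z ⟨hz.1, hxV _ hz.1⟩).trans (hf₁ x hx z hz).symm)
    refine ⟨fun z => f₁ (E.step 0 z) z, fun z => D (E.step 0 z) z,
      fun z hz => hf₁ _ hz z ⟨hz, hxV _ hz⟩, fun z hz => ?_, ih hU.tangentSet ?_⟩
    · exact hasFDerivWithinAt_of_isLittleO.2 (hinter _ hz z ⟨hz, hxV _ hz⟩)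
    · rintro ⟨z, w⟩ hz
      have hz : E.step 0 z ∈ U := hz
      refine ⟨{p : E.level 1 × E.level 0 | E.step 0 p.1 ∈ V (E.step 0 z)},
        (hVo _ hz).preimage ((E.step 0).continuous.comp continuous_fst), hxV _ hz, ?_⟩
      refine (hT _ hz).mono_congr (fun p hp => hp) fun p hp => ?_
      exact Prod.ext (hfeq _ hz _ hp).symm
        (DFunLike.congr_fun (hDeq _ hz _ hp).symm p.2)

theorem ScSmooth.of_local {U : Set (E.level 0)} {f : E.level 0 → F.level 0}
    (hU : IsUniqueDiff E U)
    (h : ∀ x ∈ U, ∃ V, IsOpen V ∧ x ∈ V ∧ ScSmooth E F (U ∩ V) f) : ScSmooth E F U f :=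
  fun k => ScClass.of_local hU fun x hx => (h x hx).imp fun _ hV => ⟨hV.1, hV.2.1, hV.2.2 k⟩

/-! ### Partial quadrants -/

theorem ScIso.incl_equiv (T : ScIso E F) :
    ∀ i x, F.incl i (T.equiv i x) = T.equiv 0 (E.incl i x)
  | 0, _ => rfl
  | i + 1, x => by
    change F.incl i (F.step i (T.equiv (i + 1) x)) = T.equiv 0 (E.incl i (E.step i x))
    rw [T.equiv_step, T.incl_equiv i]

theorem euclidean_incl (n : ℕ) : ∀ i (x : EuclideanSpace ℝ (Fin n)),
    (ScBanach.euclidean n).incl i x = x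
  | 0, _ => rfl
  | i + 1, x => euclidean_incl n i x

/-- Level `i` of a partial quadrant. -/
theorem IsPartialQuadrant.exists_level {C : Set (E.level 0)} (hC : IsPartialQuadrant E C) :
    ∃ (n : ℕ) (W : ScBanach.{u}) (T : ScIso ((ScBanach.euclidean n).prod W) E),
      ∀ i, {x : E.level i | E.incl i x ∈ C} =
        (T.equiv i).symm ⁻¹' {p : EuclideanSpace ℝ (Fin n) × W.level i | ∀ j, 0 ≤ p.1 j} := by
  obtain ⟨n, W, T, rfl⟩ := hC
  refine ⟨n, W, T, fun i => ?_⟩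
  ext x
  obtain ⟨p, rfl⟩ := (T.equiv i).surjective x
  have hp : ((ScBanach.euclidean n).prod W).incl i p = ((p.1, W.incl i p.2) :
      EuclideanSpace ℝ (Fin n) × W.level 0) :=
    (ScBanach.incl_prod _ _ i p).trans (Prod.ext (euclidean_incl n i p.1) rfl)
  simp only [mem_ofPred_eq, T.incl_equiv, mem_preimage, ContinuousLinearEquiv.symm_apply_apply]
  rw [(T.equiv 0).injective.mem_set_image, hp]
  rfl

theorem IsPartialQuadrant.convex_level {C : Set (E.level 0)} (hC : IsPartialQuadrant E C) (i : ℕ) :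
    Convex ℝ {x : E.level i | E.incl i x ∈ C} := by
  obtain ⟨n, W, T, h⟩ := hC.exists_level
  rw [h i]
  have hQ : Convex ℝ {p : EuclideanSpace ℝ (Fin n) × W.level i | ∀ j, 0 ≤ p.1 j} := by
    intro p hp q hq a b ha hb _ j
    exact add_nonneg (mul_nonneg ha (hp j)) (mul_nonneg hb (hq j))
  exact hQ.linear_preimage (T.equiv i).symm.toLinearEquiv.toLinearMap

/-- On each level the quadrant is convex, and `(1, …, 1; 0)` is an interior point. All levels are
needed because passing to tangents shifts the index. -/
theorem IsPartialQuadrant.isUniqueDiff {C : Set (E.level 0)} (hC : IsPartialQuadrant E C) :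
    IsUniqueDiff E C := by
  intro i
  refine uniqueDiffOn_convex (hC.convex_level i) ?_
  obtain ⟨n, W, T, h⟩ := hC.exists_level
  rw [h i]
  have hO : IsOpen {p : EuclideanSpace ℝ (Fin n) × W.level i | ∀ j, 0 < p.1 j} := by
    rw [ofPred_forall]
    exact isOpen_iInter_of_finite fun j => isOpen_lt continuous_const (by fun_prop)
  let q : EuclideanSpace ℝ (Fin n) × W.level i := (WithLp.toLp 2 fun _ => (1 : ℝ), 0)
  refine ⟨T.equiv i q,
    mem_interior.2 ⟨_, ?_, hO.preimage (T.equiv i).symm.continuous, ?_⟩⟩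
  · exact fun x hx j => (hx j).le
  · have hq : (T.equiv i).symm (T.equiv i q) = q := (T.equiv i).symm_apply_apply q
    refine (congrArg (fun p : EuclideanSpace ℝ (Fin n) × W.level i => ∀ j, 0 < p.1 j) hq).mpr ?_
    exact fun j => zero_lt_one

theorem IsRelOpen.isLocallyConvex {C U : Set (E.level 0)} (hU : IsRelOpen C U)
    (hC : IsPartialQuadrant E C) : IsLocallyConvex E U :=
  ⟨C, hC.convex_level 0, hU⟩

theorem IsRelOpen.isUniqueDiff {C U : Set (E.level 0)} (hU : IsRelOpen C U)
    (hC : IsPartialQuadrant E C) : IsUniqueDiff E U := by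
  obtain ⟨V, hV, rfl⟩ := hU
  exact hC.isUniqueDiff.inter hV

theorem IsRelOpen.of_isRelOpen {A : Type*} [TopologicalSpace A] {C U W : Set A}
    (hU : IsRelOpen C U) (hW : IsRelOpen U W) : IsRelOpen C W := by
  obtain ⟨V, hV, rfl⟩ := hU
  obtain ⟨V', hV', rfl⟩ := hW
  exact ⟨V ∩ V', hV.inter hV', inter_assoc _ _ _⟩

theorem _root_.ContinuousOn.isRelOpen {A B : Type*} [TopologicalSpace A] [TopologicalSpace B]
    {f : A → B} {U : Set A} (hf : ContinuousOn f U) {W : Set B} (hW : IsOpen W) :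
    IsRelOpen U (U ∩ f ⁻¹' W) := by
  obtain ⟨V, hV, h⟩ := continuousOn_iff'.1 hf W hW
  exact ⟨V, hV, by rw [inter_comm, h, inter_comm]⟩

/-! ### Smoothness on models -/

/-- An sc-smooth map on a model may be composed with any sc-smooth map into the model. -/
theorem ModelSmooth.comp {C O : Set (E.level 0)} {f : E.level 0 → F.level 0}
    (hC : IsPartialQuadrant E C) (hf : ModelSmooth E C O F f) {V : Set (G.level 0)}
    {g : G.level 0 → E.level 0} (hg : ScSmooth G E V g) (hm : MapsTo g V O) :
    ScSmooth G F V (f ∘ g) := by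
  obtain ⟨U, r, hr, rfl, hs⟩ := hf
  have hfix : ∀ x ∈ V, r (g x) = g x := by
    intro x hx
    obtain ⟨y, hy, he⟩ := hm hx
    rw [← he, hr.idem y hy]
  have hmU : MapsTo g V U := fun x hx => by
    obtain ⟨y, hy, he⟩ := hm hx
    rw [← he]; exact hr.mapsTo hy
  exact (hs.comp (hr.relOpen.isLocallyConvex hC) hg hmU).mono_congr Subset.rfl
    fun x hx => congrArg f (hfix x hx)

/-- Restriction of a retraction to the preimage of an open set. -/
theorem IsScRetraction.restrict {C U W : Set (E.level 0)} {r : E.level 0 → E.level 0}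
    (hr : IsScRetraction E C U r) {O : Set (E.level 0)} (hW : IsRelOpen U W)
    (hWO : W = U ∩ r ⁻¹' O) :
    IsScRetraction E C W r ∧ r '' W = r '' U ∩ O := by
  subst hWO
  refine ⟨⟨hr.relOpen.of_isRelOpen hW, fun x hx => ⟨hr.mapsTo hx.1, ?_⟩,
    fun x hx => hr.idem x hx.1, hr.smooth.mono inter_subset_left⟩, ?_⟩
  · change r (r x) ∈ O
    rw [hr.idem x hx.1]; exact hx.2
  · ext y
    constructor
    · rintro ⟨x, hx, rfl⟩
      exact ⟨⟨x, hx.1, rfl⟩, hx.2⟩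
    · rintro ⟨⟨x, hx, rfl⟩, hO⟩
      exact ⟨x, ⟨hx, hO⟩, rfl⟩

theorem ScSmooth.of_isEmpty {U : Set (E.level 0)} {f : E.level 0 → F.level 0} (hU : U = ∅) :
    ScSmooth E F U f := by
  subst hU
  exact ScSmooth.of_local (fun i => uniqueDiffOn_empty) fun x hx => hx.elim

theorem ModelSmooth.congr {C O : Set (E.level 0)} {f g : E.level 0 → F.level 0}
    (h : ModelSmooth E C O F f) (hfg : EqOn f g O) : ModelSmooth E C O F g := by
  obtain ⟨U, r, hr, rfl, hs⟩ := h
  exact ⟨U, r, hr, rfl, hs.mono_congr Subset.rfl fun x hx => hfg ⟨x, hx, rfl⟩⟩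

/-! ### Charts -/

section Chart

variable {X : Type u} [TopologicalSpace X] {Y : Type v} [TopologicalSpace Y]

theorem Chart.restrict_retraction (c : Chart X) {U : Set (c.E.level 0)}
    {r : c.E.level 0 → c.E.level 0} (hr : IsScRetraction c.E c.C U r) {A S : Set X}
    (hU : r '' U = c.toPartialEquiv.target ∩ c.toPartialEquiv.symm ⁻¹' A) (hS : IsOpen S) :
    ∃ V, IsScRetraction c.E c.C V r ∧
      r '' V = c.toPartialEquiv.target ∩ c.toPartialEquiv.symm ⁻¹' (A ∩ S) := by
  have hm : MapsTo r U c.toPartialEquiv.target := fun x hx => (hU ▸ mem_image_of_mem r hx :).1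
  have hc : ContinuousOn (c.toPartialEquiv.symm ∘ r) U :=
    c.continuousOn_invFun.comp hr.smooth.continuousOn hm
  obtain ⟨h1, h2⟩ := hr.restrict (hc.isRelOpen hS) (O := c.toPartialEquiv.symm ⁻¹' S) rfl
  exact ⟨_, h1, by rw [h2, hU, inter_assoc, preimage_inter]⟩

theorem Chart.exists_retraction (c : Chart X) {S : Set X} (hS : IsOpen S) :
    ∃ U r, IsScRetraction c.E c.C U r ∧
      r '' U = c.toPartialEquiv.target ∩ c.toPartialEquiv.symm ⁻¹' S := by
  obtain ⟨-, U, r, hr, hU⟩ := c.isModel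
  obtain ⟨V, hV, hV'⟩ := c.restrict_retraction (A := univ) hr (by simp [hU]) hS
  exact ⟨V, r, hV, by rw [hV', univ_inter]⟩

theorem Chart.RepSmooth.congr {c : Chart X} {d : Chart Y} {f g : X → Y} {S : Set X}
    (h : c.RepSmooth d f S) (hfg : EqOn f g S) : c.RepSmooth d g S := by
  have hS : S ∩ f ⁻¹' d.toPartialEquiv.source = S ∩ g ⁻¹' d.toPartialEquiv.source := by
    ext x
    refine and_congr_right fun hx => ?_
    rw [mem_preimage, mem_preimage, hfg hx]
  unfold Chart.RepSmooth at h ⊢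
  rw [hS] at h
  exact h.congr fun x hx => congrArg d.toPartialEquiv (hfg hx.2.1)

theorem Chart.repSmooth_of_isEmpty (c : Chart X) (d : Chart Y) {f : X → Y} {S : Set X}
    (h : S ∩ f ⁻¹' d.toPartialEquiv.source = ∅) : c.RepSmooth d f S := by
  obtain ⟨U, r, hr, hU⟩ := c.exists_retraction (isOpen_empty : IsOpen (∅ : Set X))
  refine ⟨U, r, hr, by rw [hU, h], ScSmooth.of_isEmpty ?_⟩
  rwa [preimage_empty, inter_empty, image_eq_empty] at hU

end Chart

/-! ### Sc-smooth maps -/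

section Maps

variable {X : MPolyfold.{u}} {Y : MPolyfold.{v}} {Z : MPolyfold.{w}}

theorem MSmoothOn.congr {f g : X → Y} {S : Set X} (h : MSmoothOn f S) (hfg : EqOn f g S) :
    MSmoothOn g S :=
  ⟨h.1.congr hfg.symm, fun c hc d hd => (h.2 c hc d hd).congr hfg⟩

/-- `ModelSmooth` demands a retraction with exactly the prescribed image, so the domain cannot
simply be shrunk: a retraction onto the smaller chart image comes from `Chart.exists_retraction`. -/
theorem MSmoothOn.mono {f : X → Y} {S T : Set X} (h : MSmoothOn f S) (hT : IsOpen T)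
    (hTS : T ⊆ S) : MSmoothOn f T := by
  refine ⟨h.1.mono hTS, fun c hc d hd => ?_⟩
  obtain ⟨U, r, hr, hU⟩ := c.exists_retraction
    ((h.1.mono hTS).isOpen_inter_preimage hT d.open_source)
  refine ⟨U, r, hr, hU, (h.2 c hc d hd).comp c.isModel.1 hr.smooth fun x hx => ?_⟩
  have := (hU ▸ mem_image_of_mem r hx :)
  exact ⟨this.1, hTS this.2.1, this.2.2⟩

theorem msmooth_id (X : MPolyfold.{u}) : MSmooth (id : X → X) :=
  ⟨continuousOn_id, X.compatible⟩

theorem MSmooth.msmoothOn {f : X → Y} {S : Set X} (h : MSmooth f) (hS : IsOpen S) :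
    MSmoothOn f S :=
  MSmoothOn.mono h hS (subset_univ S)

/-- No single chart of `Y` need contain the intermediate values, so a chart is chosen near each
point and the local statements are glued by `ScSmooth.of_local`. -/
theorem MSmoothOn.comp {g : Y → Z} {f : X → Y} {S : Set X} {T : Set Y} (hg : MSmoothOn g T)
    (hf : MSmoothOn f S) (hS : IsOpen S) (hST : MapsTo f S T) : MSmoothOn (g ∘ f) S := by
  have hgf : ContinuousOn (g ∘ f) S := hg.1.comp hf.1 hST
  refine ⟨hgf, fun c hc e he => ?_⟩
  obtain ⟨U, r, hr, hU⟩ := c.exists_retraction (hgf.isOpen_inter_preimage hS e.open_source)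
  have hm : ∀ x ∈ U, r x ∈ c.toPartialEquiv.target ∧ c.toPartialEquiv.symm (r x) ∈ S ∧
      g (f (c.toPartialEquiv.symm (r x))) ∈ e.toPartialEquiv.source :=
    fun x hx => (hU ▸ mem_image_of_mem r hx :)
  refine ⟨U, r, hr, hU, ScSmooth.of_local (hr.relOpen.isUniqueDiff c.isModel.1) fun x hx => ?_⟩
  obtain ⟨d, hd, hxd⟩ := Y.cover (f (c.toPartialEquiv.symm (r x)))
  have hcr : ContinuousOn (f ∘ c.toPartialEquiv.symm ∘ r) U :=
    hf.1.comp (c.continuousOn_invFun.comp hr.smooth.continuousOn fun x hx => (hm x hx).1)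
      fun x hx => (hm x hx).2.1
  obtain ⟨V, hV, hUV⟩ := hcr.isRelOpen d.open_source
  have hVd : ∀ z ∈ U ∩ V, f (c.toPartialEquiv.symm (r z)) ∈ d.toPartialEquiv.source :=
    fun z hz => (hUV ▸ hz :).2
  refine ⟨V, hV, (hUV ▸ ⟨hx, hxd⟩ : x ∈ U ∩ V).2, ?_⟩
  have h1 := (hf.2 c hc d hd).comp c.isModel.1 (hr.smooth.mono (inter_subset_left : U ∩ V ⊆ U))
    fun z hz => ⟨(hm z hz.1).1, (hm z hz.1).2.1, hVd z hz⟩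
  have h2 := (hg.2 d hd e he).comp d.isModel.1 h1 fun z hz => by
    have hz' := d.toPartialEquiv.left_inv (hVd z hz)
    refine ⟨d.toPartialEquiv.map_source (hVd z hz), ?_, ?_⟩
    · exact hz'.symm ▸ hST (hm z hz.1).2.1
    · exact (congrArg (· ∈ e.toPartialEquiv.source) (congrArg g hz')).mpr (hm z hz.1).2.2
  refine h2.mono_congr Subset.rfl fun z hz => ?_
  exact congrArg (fun y => e.toPartialEquiv (g y)) (d.toPartialEquiv.left_inv (hVd z hz))

theorem MSmooth.comp {g : Y → Z} {f : X → Y} (hg : MSmooth g) (hf : MSmooth f) :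
    MSmooth (g ∘ f) :=
  MSmoothOn.comp hg hf isOpen_univ (mapsTo_univ _ _)

/-- A smooth injective map with a smooth left inverse near its image is an sc-diffeomorphism onto
its image.  The left inverse may use an arbitrary map `X → Y` for its irrelevant values. -/
theorem isScDiffeoOnto_of_leftInverse {g : Y → X} {A T : Set X} (hg : MSmooth g)
    (hA : range g = A) (hAT : A ⊆ T) (hsub : IsSubMPolyfold A)
    (hinj : Function.Injective g)
    (hq : (X → Y) → ∃ q : X → Y, MSmoothOn q T ∧ ∀ y, q (g y) = y) :
    IsScDiffeoOnto g A where
  sub := hsub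
  smooth := hg
  injective := hinj
  range_eq := hA
  smooth_inv U r hr s hs := by
    obtain ⟨q, hq, hqg⟩ := hq s
    have hrA : MapsTo r U T := fun x hx => hAT (hr.image ▸ mem_image_of_mem r hx :).2
    refine (hq.comp hr.smooth hr.isOpen hrA).congr fun x hx => ?_
    change q (r x) = s x
    rw [← hs x hx, hqg]

theorem isSubMPolyfold_of_isOpen {A : Set X} (hA : IsOpen A) : IsSubMPolyfold A :=
  fun a ha => ⟨A, id, ha, hA, (msmooth_id X).msmoothOn hA, fun _ _ => rfl, by simp⟩

end Maps

/-! ### Closed sub-M-polyfolds with a global retraction -/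

section Sub

variable {X : MPolyfold.{u}} {A U : Set X} {r : X → X}

/-- The retraction is `ρ = c ∘ r ∘ c⁻¹ ∘ q`, where `q` is the model retraction witnessing smoothness
of `r` in the chart `c`. Since `r` takes values in `A`, and chart images of points of `A` are fixed
by `q` and by `c ∘ r ∘ c⁻¹`, the map `ρ` is idempotent with image the chart image of `A`. -/
theorem IsLocalRetraction.exists_scRetraction (hr : IsLocalRetraction A U r) (hAU : A ⊆ U)
    {c : Chart X} (hc : c ∈ X.atlas) {S : Set X} (hS : IsOpen S) :
    ∃ V ρ, IsScRetraction c.E c.C V ρ ∧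
      ρ '' V = c.toPartialEquiv.target ∩ c.toPartialEquiv.symm ⁻¹' (A ∩ S) := by
  set e := c.toPartialEquiv with he
  have hfix : ∀ a ∈ A, r a = a := by
    intro a ha
    obtain ⟨x, hx, rfl⟩ : a ∈ r '' U := hr.image ▸ ⟨hAU ha, ha⟩
    exact hr.idem x hx
  obtain ⟨V, q, hq, hV, hs⟩ := hr.smooth.2 c hc c hc
  have hm : ∀ x ∈ V, q x ∈ e.target ∧ e.symm (q x) ∈ U ∧ r (e.symm (q x)) ∈ e.source :=
    fun x hx => (hV ▸ mem_image_of_mem q hx :)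
  have hrA : ∀ x ∈ V, r (e.symm (q x)) ∈ A := fun x hx =>
    (hr.image ▸ mem_image_of_mem r (hm x hx).2.1 :).2
  have hq' : ∀ a ∈ A, a ∈ e.source → e a ∈ V ∧ q (e a) = e a := by
    intro a ha hae
    obtain ⟨x, hx, hxa⟩ : e a ∈ q '' V := by
      rw [hV]
      refine ⟨e.map_source hae, ?_⟩
      change e.symm (e a) ∈ U ∧ r (e.symm (e a)) ∈ e.source
      rw [e.left_inv hae, hfix a ha]
      exact ⟨hAU ha, hae⟩
    rw [← hxa]
    exact ⟨hq.mapsTo hx, hq.idem x hx⟩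
  have hρ : IsScRetraction c.E c.C V ((e ∘ r ∘ e.symm) ∘ q) := by
    refine ⟨hq.relOpen, fun x hx => (hq' _ (hrA x hx) (hm x hx).2.2).1, fun x hx => ?_, hs⟩
    simp only [Function.comp_apply]
    rw [(hq' _ (hrA x hx) (hm x hx).2.2).2, e.left_inv (hm x hx).2.2, hfix _ (hrA x hx)]
  have him : ((e ∘ r ∘ e.symm) ∘ q) '' V = e.target ∩ e.symm ⁻¹' A := by
    ext y
    constructor
    · rintro ⟨x, hx, rfl⟩
      refine ⟨e.map_source (hm x hx).2.2, ?_⟩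
      exact (congrArg (· ∈ A) (e.left_inv (hm x hx).2.2)).mpr (hrA x hx)
    · rintro ⟨hy, hyA⟩
      have h := hq' _ hyA (e.map_target hy)
      rw [e.right_inv hy] at h
      refine ⟨y, h.1, ?_⟩
      simp only [Function.comp_apply]
      rw [h.2, hfix _ hyA, e.right_inv hy]
  obtain ⟨V', h1, h2⟩ := c.restrict_retraction hρ him hS
  exact ⟨V', _, h1, h2⟩

open Classical in
/-- The restriction of a chart to `A`. -/
noncomputable def IsLocalRetraction.chart (hr : IsLocalRetraction A U r) (hAU : A ⊆ U) (a₀ : A)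
    (c : Chart X) (hc : c ∈ X.atlas) : Chart A where
  E := c.E
  C := c.C
  toPartialEquiv :=
    { toFun := fun a => c.toPartialEquiv a
      -- The point `a₀` is a junk value, taken only where the inverse chart of `X` leaves `A`.
      invFun := fun x => if h : c.toPartialEquiv.symm x ∈ A then ⟨_, h⟩ else a₀
      source := {a | (a : X) ∈ c.toPartialEquiv.source}
      target := c.toPartialEquiv.target ∩ c.toPartialEquiv.symm ⁻¹' A
      map_source' := fun a ha => ⟨c.toPartialEquiv.map_source ha, by
        rw [mem_preimage, c.toPartialEquiv.left_inv ha]; exact a.2⟩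
      map_target' := fun x hx => by
        rw [dif_pos (show c.toPartialEquiv.symm x ∈ A from hx.2)]
        exact c.toPartialEquiv.map_target hx.1
      left_inv' := fun a ha => by
        have h : c.toPartialEquiv.symm (c.toPartialEquiv a) = a := c.toPartialEquiv.left_inv ha
        rw [dif_pos (h.symm ▸ a.2)]
        exact Subtype.ext h
      right_inv' := fun x hx => by
        rw [dif_pos (show c.toPartialEquiv.symm x ∈ A from hx.2)]
        exact c.toPartialEquiv.right_inv hx.1 }
  isModel := by
    obtain ⟨V, ρ, h1, h2⟩ := hr.exists_scRetraction hAU hc isOpen_univ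
    exact ⟨c.isModel.1, V, ρ, h1, by rw [h2, inter_univ]⟩
  open_source := c.open_source.preimage continuous_subtype_val
  continuousOn_toFun := c.continuousOn_toFun.comp continuous_subtype_val.continuousOn fun _ ha => ha
  continuousOn_invFun := by
    rw [IsEmbedding.subtypeVal.continuousOn_iff]
    refine (c.continuousOn_invFun.mono inter_subset_left).congr fun x hx => ?_
    exact congrArg Subtype.val (dif_pos (show c.toPartialEquiv.symm x ∈ A from hx.2))

theorem IsLocalRetraction.chart_symm (hr : IsLocalRetraction A U r) (hAU : A ⊆ U) (a₀ : A)
    {c : Chart X} (hc : c ∈ X.atlas) {x : c.E.level 0}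
    (hx : c.toPartialEquiv.symm x ∈ A) :
    (hr.chart hAU a₀ c hc).toPartialEquiv.symm x = ⟨c.toPartialEquiv.symm x, hx⟩ :=
  dif_pos hx

/-- Because the charts of `A` are restrictions, this one representative serves both for
compatibility of the atlas of `A` and for smoothness of the inclusion into `X`. -/
theorem IsLocalRetraction.modelSmooth (hr : IsLocalRetraction A U r) (hAU : A ⊆ U) (a₀ : A)
    {c d : Chart X} (hc : c ∈ X.atlas) (hd : d ∈ X.atlas) :
    (hr.chart hAU a₀ c hc).RepSmooth d Subtype.val univ := by
  obtain ⟨V, ρ, h1, h2⟩ := hr.exists_scRetraction hAU hc d.open_source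
  have h3 := (X.compatible c hc d hd).comp c.isModel.1 h1.smooth fun x hx => by
    have := (h2 ▸ mem_image_of_mem ρ hx :)
    exact ⟨this.1, mem_univ _, this.2.2⟩
  refine ⟨V, ρ, h1, ?_, h3.mono_congr Subset.rfl fun x hx => ?_⟩
  · refine h2.trans ?_
    ext y
    constructor
    · rintro ⟨hy, hyA, hyd⟩
      refine ⟨⟨hy, hyA⟩, mem_univ _, ?_⟩
      rw [mem_preimage, hr.chart_symm hAU a₀ hc hyA]
      exact hyd
    · rintro ⟨⟨hy, hyA⟩, -, hyd⟩
      rw [mem_preimage, hr.chart_symm hAU a₀ hc hyA] at hyd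
      exact ⟨hy, hyA, hyd⟩
  · have hA : c.toPartialEquiv.symm (ρ x) ∈ A := (h2 ▸ mem_image_of_mem ρ hx :).2.1
    exact congrArg (fun a : A => d.toPartialEquiv a) (hr.chart_symm hAU a₀ hc hA).symm

/-- The M-polyfold structure induced on a closed set `A` by a retraction of a neighbourhood. -/
noncomputable def IsLocalRetraction.toMPolyfold (hr : IsLocalRetraction A U r) (hAU : A ⊆ U)
    (hA : IsClosed A) : MPolyfold.{u} where
  carrier := A
  -- Closedness enters here: a closed subspace of a paracompact space is paracompact.
  paracompact := hA.isClosedEmbedding_subtypeVal.paracompactSpace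
  atlas := {d | ∃ (a₀ : A) (c : Chart X) (hc : c ∈ X.atlas), d = hr.chart hAU a₀ c hc}
  cover a := by
    obtain ⟨c, hc, ha⟩ := X.cover a
    exact ⟨_, ⟨a, c, hc, rfl⟩, ha⟩
  compatible := by
    rintro _ ⟨a₀, c, hc, rfl⟩ _ ⟨a₁, d, hd, rfl⟩
    exact hr.modelSmooth hAU a₀ hc hd

variable (hr : IsLocalRetraction A U r) (hAU : A ⊆ U) (hA : IsClosed A)

/-- The inclusion of a sub-M-polyfold. -/
def IsLocalRetraction.incl : hr.toMPolyfold hAU hA → X := Subtype.val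

theorem IsLocalRetraction.msmooth_incl : MSmooth (hr.incl hAU hA) := by
  refine ⟨continuous_subtype_val.continuousOn, ?_⟩
  rintro _ ⟨a₀, c, hc, rfl⟩ d hd
  exact hr.modelSmooth hAU a₀ hc hd

theorem IsLocalRetraction.msmoothOn_codRestrict {Z : MPolyfold.{v}} {f : Z → X} {S : Set Z}
    (hf : MSmoothOn f S) {s : Z → hr.toMPolyfold hAU hA}
    (hs : ∀ z ∈ S, hr.incl hAU hA (s z) = f z) : MSmoothOn s S := by
  have hf' : MSmoothOn (hr.incl hAU hA ∘ s) S := hf.congr fun z hz => (hs z hz).symm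
  refine ⟨IsEmbedding.subtypeVal.continuousOn_iff.2 hf'.1, ?_⟩
  rintro c hc _ ⟨a₀, d, hd, rfl⟩
  exact hf'.2 c hc d hd

end Sub

/-! ### Disjoint unions -/

/-- Refinements of the summands that are indexed by the original cover can be assembled index by
index; local finiteness is tested inside a single open summand. -/
theorem paracompactSpace_sigma {ι : Type*} {P : ι → Type*} [∀ i, TopologicalSpace (P i)]
    [∀ i, ParacompactSpace (P i)] : ParacompactSpace (Σ i, P i) where
  locallyFinite_refinement := by
    intro α u huo hu
    have h : ∀ i, ∃ v : α → Set (P i), (∀ a, IsOpen (v a)) ∧ ⋃ a, v a = univ ∧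
        LocallyFinite v ∧ ∀ a, v a ⊆ Sigma.mk i ⁻¹' u a := fun i =>
      precise_refinement _ (fun a => (huo a).preimage continuous_sigmaMk) (by
        rw [← preimage_iUnion, hu, preimage_univ])
    choose v hvo hv hvf hvu using h
    refine ⟨α, fun a => {y | y.2 ∈ v y.1 a}, fun a => isOpen_sigma_iff.2 fun i => hvo i a, ?_, ?_,
      fun a => ⟨a, fun y hy => hvu y.1 a hy⟩⟩
    · refine eq_univ_of_forall fun y => ?_
      obtain ⟨a, ha⟩ := mem_iUnion.1 (hv y.1 ▸ mem_univ y.2 : y.2 ∈ ⋃ a, v y.1 a)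
      exact mem_iUnion.2 ⟨a, ha⟩
    · rintro ⟨i, p⟩
      obtain ⟨N, hN, hfin⟩ := hvf i p
      refine ⟨Sigma.mk i '' N, (IsOpenEmbedding.sigmaMk.image_mem_nhds).2 hN, hfin.subset ?_⟩
      rintro a ⟨_, h, q, hq, rfl⟩
      exact ⟨q, h, hq⟩

section Sigma

variable {ι : Type} {P : ι → MPolyfold.{u}}

open Classical in
/-- Extension by zero of a map on a summand. -/
noncomputable def sigmaExtend {A : Type*} [Zero A] (i : ι) (f : P i → A) : (Σ i, P i) → A :=
  fun y => if h : y.1 = i then f (h ▸ y.2) else 0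

theorem sigmaExtend_mk {A : Type*} [Zero A] (i : ι) (f : P i → A) (p : P i) :
    sigmaExtend i f ⟨i, p⟩ = f p :=
  dif_pos rfl

/-- A chart on a summand, as a chart on the disjoint union. -/
noncomputable def sigmaChart (i : ι) (c : Chart (P i)) : Chart (Σ i, P i) where
  E := c.E
  C := c.C
  toPartialEquiv :=
    { toFun := sigmaExtend i c.toPartialEquiv
      invFun := fun x => ⟨i, c.toPartialEquiv.symm x⟩
      source := Sigma.mk i '' c.toPartialEquiv.source
      target := c.toPartialEquiv.target
      map_source' := by
        rintro _ ⟨p, hp, rfl⟩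
        rw [sigmaExtend_mk]
        exact c.toPartialEquiv.map_source hp
      map_target' := fun x hx => ⟨_, c.toPartialEquiv.map_target hx, rfl⟩
      left_inv' := by
        rintro _ ⟨p, hp, rfl⟩
        rw [sigmaExtend_mk]
        exact congrArg (Sigma.mk i) (c.toPartialEquiv.left_inv hp)
      right_inv' := fun x hx => by
        rw [sigmaExtend_mk]
        exact c.toPartialEquiv.right_inv hx }
  isModel := c.isModel
  open_source := isOpenMap_sigmaMk _ c.open_source
  continuousOn_toFun := by
    rintro _ ⟨p, hp, rfl⟩
    refine ContinuousAt.continuousWithinAt ?_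
    refine IsOpenEmbedding.sigmaMk.continuousAt_iff.1 ?_
    refine (c.continuousOn_toFun.continuousAt (c.open_source.mem_nhds hp)).congr ?_
    exact .of_forall fun q => (sigmaExtend_mk i c.toPartialEquiv q).symm
  continuousOn_invFun := continuous_sigmaMk.comp_continuousOn c.continuousOn_invFun

theorem sigmaChart_apply (i : ι) (c : Chart (P i)) (p : P i) :
    (sigmaChart i c).toPartialEquiv ⟨i, p⟩ = c.toPartialEquiv p :=
  sigmaExtend_mk i _ p

theorem repSmooth_sigmaMk {i j : ι} {c : Chart (P i)} (hc : c ∈ (P i).atlas) {d : Chart (P j)}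
    (hd : d ∈ (P j).atlas) : c.RepSmooth (sigmaChart j d) (fun p => ⟨i, p⟩) univ := by
  by_cases hij : i = j
  · subst hij
    have h := (P i).compatible c hc d hd
    unfold Chart.RepSmooth at h ⊢
    have hS : (fun p : P i => (⟨i, p⟩ : Σ i, P i)) ⁻¹'
      (sigmaChart i d).toPartialEquiv.source = id ⁻¹' d.toPartialEquiv.source :=
      preimage_image_eq _ (sigma_mk_injective (β := fun i => P i))
    rw [hS]
    exact h.congr fun x _ => (sigmaChart_apply i d _).symm
  · refine c.repSmooth_of_isEmpty _ (eq_empty_of_forall_notMem ?_)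
    rintro p ⟨-, q, -, hq⟩
    exact hij (congrArg Sigma.fst hq).symm

variable (P) in
/-- The disjoint union of a family of M-polyfolds. -/
noncomputable def MPolyfold.sigma : MPolyfold.{u} where
  carrier := Σ i, P i
  paracompact := paracompactSpace_sigma
  atlas := {d | ∃ (i : ι) (c : Chart (P i)), c ∈ (P i).atlas ∧ d = sigmaChart i c}
  cover := by
    rintro ⟨i, p⟩
    obtain ⟨c, hc, hp⟩ := (P i).cover p
    exact ⟨_, ⟨i, c, hc, rfl⟩, p, hp, rfl⟩
  compatible := by
    rintro _ ⟨i, c, hc, rfl⟩ _ ⟨j, d, hd, rfl⟩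
    exact repSmooth_sigmaMk hc hd

/-- The inclusion of a summand. -/
def MPolyfold.sigmaMk (i : ι) (p : P i) : MPolyfold.sigma P := ⟨i, p⟩

theorem msmooth_sigmaMk (i : ι) : MSmooth (MPolyfold.sigmaMk (P := P) i) := by
  refine ⟨(continuous_sigmaMk (σ := fun i => P i)).continuousOn, ?_⟩
  rintro c hc _ ⟨j, d, hd, rfl⟩
  exact repSmooth_sigmaMk hc hd

theorem msmoothOn_sigma {Z : MPolyfold.{v}} {f : MPolyfold.sigma P → Z}
    {S : Set (MPolyfold.sigma P)} (hS : IsOpen S)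
    (h : ∀ i, MSmoothOn (f ∘ MPolyfold.sigmaMk i) (MPolyfold.sigmaMk i ⁻¹' S)) :
    MSmoothOn f S := by
  refine ⟨?_, ?_⟩
  · rintro ⟨i, p⟩ hp
    refine ContinuousAt.continuousWithinAt ?_
    refine (IsOpenEmbedding.sigmaMk (σ := fun i => P i)).continuousAt_iff.1 ?_
    exact (h i).1.continuousAt ((hS.preimage (continuous_sigmaMk (σ := fun i => P i))).mem_nhds hp)
  · rintro _ ⟨i, c, hc, rfl⟩ d hd
    exact (h i).2 c hc d hd

end Sigma

/-! ### The inverse function theorem on a neighbourhood -/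

/-- The usual theorem gives smoothness of the inverse at one point only. The local inverse is
restricted to the points where the derivative is invertible, an open condition, and the theorem is
applied at each of them. -/
theorem exists_smooth_openPartialHomeomorph {A B : Type*} [NormedAddCommGroup A] [NormedSpace ℝ A]
    [CompleteSpace A] [NormedAddCommGroup B] [NormedSpace ℝ B] {f : A → B} {S : Set A}
    (hS : IsOpen S) (hf : ContDiffOn ℝ ∞ f S) {a : A} (ha : a ∈ S) {f' : A ≃L[ℝ] B}
    (hf' : HasFDerivAt f (f' : A →L[ℝ] B) a) :
    ∃ e : OpenPartialHomeomorph A B, a ∈ e.source ∧ e.source ⊆ S ∧ (e : A → B) = f ∧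
      ContDiffOn ℝ ∞ e.symm e.target := by
  have hfa : ContDiffAt ℝ ∞ f a := hf.contDiffAt (hS.mem_nhds ha)
  set e := hfa.toOpenPartialHomeomorph f hf' (by simp)
  set T := S ∩ fderiv ℝ f ⁻¹' range ((↑) : (A ≃L[ℝ] B) → A →L[ℝ] B)
  have hT : IsOpen T :=
    (hf.continuousOn_fderiv_of_isOpen hS (by simp)).isOpen_inter_preimage hS
      ContinuousLinearEquiv.isOpen
  have haT : a ∈ T := ⟨ha, f', hf'.fderiv.symm⟩
  refine ⟨e.restrOpen T hT, ⟨hfa.mem_toOpenPartialHomeomorph_source hf' (by simp), haT⟩,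
    fun x hx => hx.2.1, rfl, fun y hy => ContDiffAt.contDiffWithinAt ?_⟩
  have hx := (e.restrOpen T hT).map_target hy
  set x := (e.restrOpen T hT).symm y
  obtain ⟨hxS, L, hL⟩ := (show x ∈ T from hx.2)
  have hxf : ContDiffAt ℝ ∞ f x := hf.contDiffAt (hS.mem_nhds hxS)
  refine OpenPartialHomeomorph.contDiffAt_symm _ (f₀' := L) hy ?_ hxf
  rw [hL]
  exact (hxf.differentiableAt (by simp)).hasFDerivAt

/-! ### Local structure of immersions -/

section Immersion

variable {n N : ℕ} {M : Type*} [TopologicalSpace M] [ChartedSpace (RSpace n) M]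

/-- In immersion charts the map reads `u ↦ (u, 0)`; projecting to the first factor gives a
differentiable left inverse, so the derivative is injective. -/
theorem exists_chart_of_isImmersionAt [IsManifold (𝓡 n) ∞ M] {φ : M → RSpace N} {x : M}
    (hφ : Manifold.IsImmersionAt (𝓡 n) (𝓡 N) ∞ φ x) :
    ∃ e : OpenPartialHomeomorph M (RSpace n), x ∈ e.source ∧
      ContDiffOn ℝ ∞ (φ ∘ e.symm) e.target ∧
      Function.Injective (fderiv ℝ (φ ∘ e.symm) (e x)) := by
  set e := hφ.domChart with he
  have hxe : x ∈ e.source := hφ.mem_domChart_source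
  have hs : ContDiffOn ℝ ∞ (φ ∘ e.symm) e.target := by
    rw [← contMDiffOn_iff_contDiffOn]
    exact hφ.contMDiffOn.comp (contMDiffOn_symm_of_mem_maximalAtlas hφ.domChart_mem_maximalAtlas)
      fun y hy => e.map_target hy
  refine ⟨e, hxe, hs, ?_⟩
  set c := hφ.codChart
  have hc : ContDiffAt ℝ ∞ c (φ x) := by
    have := contMDiffOn_of_mem_maximalAtlas hφ.codChart_mem_maximalAtlas
    exact (contMDiffOn_iff_contDiffOn.1 this).contDiffAt
      (c.open_source.mem_nhds hφ.mem_codChart_source)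
  have hex : e.symm (e x) = x := e.left_inv hxe
  have hg : DifferentiableAt ℝ (φ ∘ e.symm) (e x) :=
    (hs.contDiffAt (e.open_target.mem_nhds (e.map_source hxe))).differentiableAt (by simp)
  have hc' : DifferentiableAt ℝ c ((φ ∘ e.symm) (e x)) := by
    rw [Function.comp_apply, hex]
    exact hc.differentiableAt (by simp)
  let p : RSpace N →L[ℝ] RSpace n :=
    (ContinuousLinearMap.fst ℝ (RSpace n) hφ.complement).comp
      (hφ.equiv.symm : RSpace N →L[ℝ] RSpace n × hφ.complement)
  have hid : (fun u => p (c ((φ ∘ e.symm) u))) =ᶠ[𝓝 (e x)] id := by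
    filter_upwards [e.open_target.mem_nhds (e.map_source hxe)] with u hu
    have hu' : u ∈ (hφ.domChart.extend (𝓡 n)).target := by
      rw [OpenPartialHomeomorph.extend_target]
      simpa using hu
    have := hφ.writtenInCharts hu'
    simp only [Function.comp_apply, OpenPartialHomeomorph.extend_coe, modelWithCornersSelf_coe,
      OpenPartialHomeomorph.extend_coe_symm, modelWithCornersSelf_coe_symm, id] at this
    change (hφ.equiv.symm (c (φ (e.symm u)))).1 = u
    rw [this, ContinuousLinearEquiv.symm_apply_apply]
  have hcomp := (p.hasFDerivAt.comp _ (hc'.hasFDerivAt.comp _ hg.hasFDerivAt)).congr_of_eventuallyEq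
    hid.symm
  have := hcomp.unique (hasFDerivAt_id _)
  intro v w hvw
  have h1 := DFunLike.congr_fun this v
  have h2 := DFunLike.congr_fun this w
  simp only [ContinuousLinearMap.comp_apply, ContinuousLinearMap.id_apply] at h1 h2
  rw [← h1, ← h2, hvw]

/-- Smooth functions on a closed submanifold extend to smooth functions on the ambient space. -/
theorem exists_contDiff_extension {U : Set (RSpace N)} {π : RSpace N → M} (hU : IsOpen U)
    (hπ : ContMDiffOn (𝓡 N) (𝓡 n) ∞ π U) {A : Set (RSpace N)} (hA : IsClosed A) (hAU : A ⊆ U)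
    {L : ℕ} {f : M → RSpace L} (hf : ContMDiff (𝓡 n) (𝓡 L) ∞ f) :
    ∃ F : RSpace N → RSpace L, ContDiff ℝ ∞ F ∧
      ∃ V, IsOpen V ∧ A ⊆ V ∧ V ⊆ U ∧ ∀ y ∈ V, F y = f (π y) := by
  obtain ⟨β, h0, h1, -⟩ := exists_contMDiffMap_zero_one_nhds_of_isClosed (n := ⊤) (𝓡 N)
    hU.isClosed_compl hA (disjoint_compl_left_iff_subset.2 hAU)
  have hfπ : ContDiffOn ℝ ∞ (f ∘ π) U := contMDiffOn_iff_contDiffOn.1 (hf.comp_contMDiffOn hπ)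
  refine ⟨fun y => β y • f (π y), contDiff_iff_contDiffAt.2 fun y => ?_, ?_⟩
  · by_cases hy : y ∈ U
    · exact β.contMDiff.contDiff.contDiffAt.smul (hfπ.contDiffAt (hU.mem_nhds hy))
    · refine (contDiffAt_const (c := (0 : RSpace L))).congr_of_eventuallyEq ?_
      filter_upwards [eventually_nhdsSet_iff_forall.1 h0 y hy] with z hz
      rw [hz, zero_smul]
  · obtain ⟨V, hV, hAV, hV1⟩ := mem_nhdsSet_iff_exists.1 h1
    refine ⟨V ∩ U, hV.inter hU, subset_inter hAV hAU, inter_subset_right, fun y hy => ?_⟩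
    have : β y = 1 := hV1 hy.1
    simp only [this, one_smul]

end Immersion

/-! ### Smooth retractions onto closed submanifolds -/

section Tubular

variable {n N : ℕ} {M : Type*} [TopologicalSpace M] [ChartedSpace (RSpace n) M]
  [IsManifold (𝓡 n) ∞ M]

open Module in
/-- Near a point of a submanifold, nearest points are unique and depend smoothly on the point. -/
theorem exists_smooth_nearest {φ : M → RSpace N} {x : M}
    (hφ : Manifold.IsImmersionAt (𝓡 n) (𝓡 N) ∞ φ x) (hind : IsInducing φ) :
    ∃ (V : Set (RSpace N)) (h : RSpace N → RSpace N), IsOpen V ∧ φ x ∈ V ∧ ContDiffOn ℝ ∞ h V ∧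
      ∀ y ∈ V, ∀ z, (∀ z', dist y (φ z) ≤ dist y (φ z')) → φ z = h y := by
  obtain ⟨e, hxe, hs, hinj⟩ := exists_chart_of_isImmersionAt hφ
  set g := φ ∘ e.symm with hg
  set a := e x with ha
  have hae : a ∈ e.target := e.map_source hxe
  have hga : g a = φ x := congrArg φ (e.left_inv hxe)
  have hgd : ∀ w ∈ e.target, HasFDerivAt g (fderiv ℝ g w) w := fun w hw =>
    ((hs.contDiffAt (e.open_target.mem_nhds hw)).differentiableAt (by simp)).hasFDerivAt
  -- the equation for critical points of the distance
  let Γ : RSpace n × RSpace N → (RSpace n →L[ℝ] ℝ) := fun p =>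
    (innerSL ℝ (g p.1 - p.2)).comp (fderiv ℝ g p.1)
  let Ψ : RSpace n × RSpace N → (RSpace n →L[ℝ] ℝ) × RSpace N := fun p => (Γ p, p.2)
  have hS : IsOpen (e.target ×ˢ (univ : Set (RSpace N))) := e.open_target.prod isOpen_univ
  have hg1 : ContDiffOn ℝ ∞ (fun p : RSpace n × RSpace N => g p.1) (e.target ×ˢ univ) :=
    hs.comp contDiffOn_fst fun p hp => hp.1
  have hg2 : ContDiffOn ℝ ∞ (fun p : RSpace n × RSpace N => fderiv ℝ g p.1) (e.target ×ˢ univ) :=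
    (hs.fderiv_of_isOpen e.open_target (by simp)).comp contDiffOn_fst fun p hp => hp.1
  have hΨ : ContDiffOn ℝ ∞ Ψ (e.target ×ˢ univ) :=
    (((innerSL ℝ).contDiff.comp_contDiffOn (hg1.sub contDiffOn_snd)).clm_comp hg2).prodMk
      contDiffOn_snd
  set A := fderiv ℝ g a with hA
  have hmem : (a, φ x) ∈ e.target ×ˢ (univ : Set (RSpace N)) := ⟨hae, mem_univ _⟩
  obtain ⟨Ψ', hΨ'⟩ : ∃ Ψ' : (RSpace n × RSpace N) ≃L[ℝ] (RSpace n →L[ℝ] ℝ) × RSpace N,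
      HasFDerivAt Ψ (Ψ' : (RSpace n × RSpace N) →L[ℝ] _) (a, φ x) := by
    have h1 : HasFDerivAt (fun p : RSpace n × RSpace N => g p.1)
        (A.comp (.fst ℝ _ _)) (a, φ x) :=
      (show HasFDerivAt g A (a, φ x).1 from hgd a hae).comp (a, φ x) hasFDerivAt_fst
    have h2 : HasFDerivAt (fun p : RSpace n × RSpace N => innerSL ℝ (g p.1 - p.2))
        ((innerSL ℝ).comp (A.comp (.fst ℝ _ _) - .snd ℝ _ _)) (a, φ x) :=
      (innerSL ℝ).hasFDerivAt.comp (a, φ x) (h1.sub hasFDerivAt_snd)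
    have h3 : HasFDerivAt (fun p : RSpace n × RSpace N => fderiv ℝ g p.1)
        (fderiv ℝ (fun p : RSpace n × RSpace N => fderiv ℝ g p.1) (a, φ x)) (a, φ x) :=
      ((hg2.contDiffAt (hS.mem_nhds hmem)).differentiableAt (by simp)).hasFDerivAt
    -- At `(a, φ x)` the vector `g a - φ x` vanishes, so the second derivative of `g` drops out of
    -- `D`. Then injectivity of `A`, tested through `⟨A v, A v⟩ = 0`, makes `D` injective.
    obtain ⟨D, hD, hDapp⟩ : ∃ D : (RSpace n × RSpace N) →L[ℝ] (RSpace n →L[ℝ] ℝ) × RSpace N,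
        HasFDerivAt Ψ D (a, φ x) ∧ ∀ q, D q = ((innerSL ℝ (A q.1 - q.2)).comp A, q.2) := by
      refine ⟨_, (h2.clm_comp h3).prodMk hasFDerivAt_snd, fun q => ?_⟩
      refine Prod.ext (ContinuousLinearMap.ext fun w => ?_) rfl
      simp [hga, hA]
    have hDinj : Function.Injective D.toLinearMap := by
      rw [← LinearMap.ker_eq_bot, LinearMap.ker_eq_bot']
      rintro ⟨v, w⟩ hvw
      have hvw : D (v, w) = 0 := hvw
      rw [hDapp] at hvw
      obtain ⟨h1, rfl⟩ := Prod.mk_inj.1 hvw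
      have h2 := DFunLike.congr_fun h1 v
      simp only [sub_zero, ContinuousLinearMap.comp_apply, innerSL_apply_apply,
        zero_apply, inner_self_eq_zero] at h2
      have : v = 0 := hinj (h2.trans (map_zero _).symm)
      rw [this]; rfl
    have hdim : finrank ℝ (RSpace n × RSpace N) =
        finrank ℝ ((RSpace n →L[ℝ] ℝ) × RSpace N) := by
      rw [finrank_prod, finrank_prod,
        ← (LinearMap.toContinuousLinearMap : (RSpace n →ₗ[ℝ] ℝ) ≃ₗ[ℝ] _).finrank_eq,
        Subspace.dual_finrank_eq]
    exact ⟨(D.toLinearMap.linearEquivOfInjective hDinj hdim).toContinuousLinearEquiv, hD⟩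
  obtain ⟨E, hE, hES, hEΨ, hEs⟩ := exists_smooth_openPartialHomeomorph hS hΨ hmem hΨ'
  have hEa : E (a, φ x) = (0, φ x) := by
    rw [hEΨ]
    refine Prod.ext (ContinuousLinearMap.ext fun w => ?_) rfl
    simp [Ψ, Γ, hga]
  obtain ⟨W, hW, B, hB, hWB⟩ := mem_nhds_prod_iff.1 (E.open_source.mem_nhds hE)
  have hP : {z | z ∈ e.source ∧ e z ∈ W} ∈ 𝓝 x :=
    inter_mem (e.open_source.mem_nhds hxe) ((e.continuousAt hxe).preimage_mem_nhds hW)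
  -- The inducing property excludes other sheets: points of the submanifold near `φ x` come from
  -- parameters near `x`.
  rw [hind.nhds_eq_comap] at hP
  obtain ⟨B', hB', hPB⟩ := hP
  obtain ⟨ε, hε, hεB⟩ := Metric.mem_nhds_iff.1 (inter_mem hB hB')
  have hc : Continuous fun y : RSpace N => ((0 : RSpace n →L[ℝ] ℝ), y) := by fun_prop
  -- A nearest point of the image to `y` is no farther from `y` than `φ x` is, so radius `ε / 2`
  -- keeps it within `ε` of `φ x`.
  refine ⟨Metric.ball (φ x) (ε / 2) ∩ (fun y => ((0 : RSpace n →L[ℝ] ℝ), y)) ⁻¹' E.target,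
    fun y => g (E.symm (0, y)).1, Metric.isOpen_ball.inter (E.open_target.preimage hc),
    ⟨Metric.mem_ball_self (half_pos hε), ?_⟩, ?_, ?_⟩
  · rw [mem_preimage, ← hEa]
    exact E.map_source hE
  · refine hs.comp ((contDiff_fst.comp_contDiffOn hEs).comp
      (contDiff_const.prodMk contDiff_id).contDiffOn fun y hy => hy.2) fun y hy => ?_
    exact (hES (E.map_target hy.2)).1
  · rintro y ⟨hy, -⟩ z hz
    rw [Metric.mem_ball] at hy
    have hzx : φ z ∈ Metric.ball (φ x) ε := by
      rw [Metric.mem_ball]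
      linarith [dist_triangle (φ z) y (φ x), dist_comm (φ z) y, hz x]
    obtain ⟨hze, hzW⟩ := hPB (hεB hzx).2
    have hge : g (e z) = φ z := congrArg φ (e.left_inv hze)
    have hyB : y ∈ B := (hεB (Metric.ball_subset_ball (half_le_self hε.le) hy)).1
    have hΓ : Γ (e z, y) = 0 := by
      have hmin : IsLocalMin (fun w => ‖g w - y‖ ^ 2) (e z) := by
        refine Eventually.of_forall fun w => ?_
        have := hz (e.symm w)
        rw [dist_comm, dist_comm y, dist_eq_norm, dist_eq_norm] at this
        simp only [hge]
        exact pow_le_pow_left₀ (norm_nonneg _) this 2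
      have hd := ((hgd _ (e.map_source hze)).sub_const y).norm_sq
      have h0 := hmin.hasFDerivAt_eq_zero hd
      rw [← Nat.cast_smul_eq_nsmul ℝ] at h0
      exact (smul_eq_zero.1 h0).resolve_left (by norm_num)
    have hEz : E (e z, y) = (0, y) := by rw [hEΨ]; exact Prod.ext hΓ rfl
    have := E.left_inv (hWB (show (e z, y) ∈ W ×ˢ B from ⟨hzW, hyB⟩))
    rw [hEz] at this
    simp only [this, hge]

/-- A retraction onto a closed submanifold, defined and smooth on a neighbourhood. -/
theorem exists_smooth_retraction [Nonempty M] {φ : M → RSpace N}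
    (hφ : Manifold.IsSmoothEmbedding (𝓡 n) (𝓡 N) ∞ φ) (hcl : IsClosed (range φ)) :
    ∃ (U : Set (RSpace N)) (π : RSpace N → M), IsOpen U ∧ range φ ⊆ U ∧
      ContMDiffOn (𝓡 N) (𝓡 n) ∞ π U ∧ ∀ x, π (φ x) = x := by
  have himm := hφ.isImmersion.isImmersionAt
  have hex : ∀ y : RSpace N, ∃ x : M, ∀ z, dist y (φ x) ≤ dist y (φ z) := fun y => by
    obtain ⟨_, ⟨x, rfl⟩, hx⟩ := hcl.exists_infDist_eq_dist (range_nonempty φ) y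
    exact ⟨x, fun z => hx ▸ Metric.infDist_le_dist_of_mem (mem_range_self z)⟩
  -- Where nearest points are not unique, `π` is an arbitrary choice; only the union of the sets `V
  -- x` matters.
  choose π hπ using hex
  choose V h hV hxV hh hVh using fun x => exists_smooth_nearest (himm x) hφ.isEmbedding.isInducing
  refine ⟨⋃ x, V x, π, isOpen_iUnion hV, ?_, fun y hy => ?_, fun x => ?_⟩
  · rintro _ ⟨x, rfl⟩
    exact mem_iUnion.2 ⟨x, hxV x⟩
  · obtain ⟨x, hy⟩ := mem_iUnion.1 hy
    refine ContMDiffAt.contMDiffWithinAt ?_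
    have hVy : V x ∈ 𝓝 y := (hV x).mem_nhds hy
    have hd : ContDiffAt ℝ ∞ (φ ∘ π) y :=
      ((hh x).contDiffAt hVy).congr_of_eventuallyEq (by
        filter_upwards [hVy] with z hz using hVh x z hz _ (hπ z))
    -- Near `y` the composite `φ ∘ π` is the smooth map `h x`; continuity of `π` follows as `φ` is
    -- inducing, and smoothness lifts through the immersion.
    refine (ContMDiffAt.iff_comp_isImmersionAt (himm (π y))).2 ⟨?_, hd.contMDiffAt⟩
    exact hφ.isEmbedding.isInducing.continuousAt_iff.2 hd.continuousAt
  · have := hπ (φ x) x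
    rw [dist_self] at this
    exact hφ.isEmbedding.injective (dist_le_zero.1 this).symm

end Tubular
/-! ### Exhaustion of connected paracompact manifolds -/

/-- Take a locally finite cover by relatively compact open sets and, starting from a point,
repeatedly adjoin the closures of all members that meet the current set. Local finiteness keeps each
stage compact, and the union of the stages is clopen, hence everything. -/
theorem sigmaCompactSpace_of_connected (X : Type*) [TopologicalSpace X] [T2Space X]
    [LocallyCompactSpace X] [ParacompactSpace X] [ConnectedSpace X] : SigmaCompactSpace X := by
  choose K hK hxK using fun x : X => exists_compact_mem_nhds x
  obtain ⟨v, hvo, hv, hvf, hvK⟩ := precise_refinement (fun x => interior (K x))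
    (fun x => isOpen_interior)
    (eq_univ_of_forall fun x => mem_iUnion.2 ⟨x, mem_interior_iff_mem_nhds.2 (hxK x)⟩)
  have hvc : ∀ a, IsCompact (closure (v a)) := fun a =>
    (hK a).of_isClosed_subset isClosed_closure
      (closure_minimal ((hvK a).trans interior_subset) (hK a).isClosed)
  let next : Set X → Set X := fun C => ⋃ a ∈ {a | (v a ∩ C).Nonempty}, closure (v a)
  obtain ⟨x₀⟩ : Nonempty X := inferInstance
  let C : ℕ → Set X := fun n => next^[n] {x₀}
  have hC : ∀ n, C (n + 1) = next (C n) := fun n => Function.iterate_succ_apply' next n _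
  have hCc : ∀ n, IsCompact (C n) := by
    intro n
    induction n with
    | zero => exact isCompact_singleton
    | succ n ih =>
      rw [hC]
      exact (hvf.finite_nonempty_inter_compact ih).isCompact_biUnion fun a _ => hvc a
  have hstep : ∀ n a, (v a ∩ C n).Nonempty → v a ⊆ C (n + 1) := fun n a h => by
    rw [hC]
    exact subset_closure.trans (subset_biUnion_of_mem (u := fun a => closure (v a)) h)
  have hcov : ∀ x, ∃ a, x ∈ v a := fun x => mem_iUnion.1 (hv ▸ mem_univ x)
  have hclopen : IsClopen (⋃ n, C n) := by
    refine ⟨isClosed_of_closure_subset fun y hy => ?_, isOpen_iff_mem_nhds.2 fun y hy => ?_⟩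
    · obtain ⟨a, ha⟩ := hcov y
      obtain ⟨z, hza, hz⟩ := mem_closure_iff.1 hy (v a) (hvo a) ha
      obtain ⟨n, hn⟩ := mem_iUnion.1 hz
      exact mem_iUnion.2 ⟨n + 1, hstep n a ⟨z, hza, hn⟩ ha⟩
    · obtain ⟨n, hn⟩ := mem_iUnion.1 hy
      obtain ⟨a, ha⟩ := hcov y
      exact mem_of_superset ((hvo a).mem_nhds ha)
        ((hstep n a ⟨y, ha, hn⟩).trans (subset_iUnion C (n + 1)))
  refine ⟨C, hCc, hclopen.eq_univ ⟨x₀, mem_iUnion.2 ⟨0, rfl⟩⟩⟩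

section Manifold

variable {n : ℕ} {M : Type*} [TopologicalSpace M] [ChartedSpace (RSpace n) M]
  [IsManifold (𝓡 n) ∞ M] [T2Space M]

/-- A partition of unity produces a smooth `f` above the index of the first exhausting compact set
containing the point, so sublevel sets lie in members of the exhaustion. -/
theorem exists_smooth_exhaustion [SigmaCompactSpace M] :
    ∃ f : M → ℝ, ContMDiff (𝓡 n) 𝓘(ℝ, ℝ) ∞ f ∧ ∀ a, IsCompact {x | f x ≤ a} := by
  have : LocallyCompactSpace M := ChartedSpace.locallyCompactSpace (RSpace n) M
  let K := CompactExhaustion.choice M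
  obtain ⟨f, hf⟩ := exists_contMDiffMap_forall_mem_convex_of_local_const (n := ⊤) (𝓡 n)
    (t := fun x : M => Ici (K.find x : ℝ)) (fun x => convex_Ici _) fun x => by
      refine ⟨K.find x + 1, ?_⟩
      filter_upwards [mem_interior_iff_mem_nhds.1 (K.subset_interior_succ _ (K.mem_find x))]
        with y hy
      show (K.find y : ℝ) ≤ K.find x + 1
      exact_mod_cast K.mem_iff_find_le.1 hy
  refine ⟨f, f.contMDiff, fun a => ?_⟩
  obtain ⟨N, hN⟩ := exists_nat_ge a
  refine (K.isCompact N).of_isClosed_subset (isClosed_le f.contMDiff.continuous continuous_const) ?_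
  intro x hx
  refine K.mem_iff_find_le.2 ?_
  have h1 : (K.find x : ℝ) ≤ f x := hf x
  exact_mod_cast h1.trans (le_trans hx hN)

/-! ### Embedding compact subsets -/

/-- `g` is injective on `K` and immersive at the points of `K`. -/
structure IsEmbeddingOn {V : Type*} [NormedAddCommGroup V] [NormedSpace ℝ V] (g : M → V)
    (K : Set M) : Prop where
  contMDiff : ContMDiff (𝓡 n) 𝓘(ℝ, V) ∞ g
  injOn : InjOn g K
  injective_mfderiv : ∀ x ∈ K, Function.Injective (mfderiv (𝓡 n) 𝓘(ℝ, V) g x)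

variable {V W : Type*} [NormedAddCommGroup V] [NormedSpace ℝ V]
  [NormedAddCommGroup W] [NormedSpace ℝ W]

omit [IsManifold (𝓡 n) ∞ M] [T2Space M] in
theorem mfderiv_clm_comp {g : M → V} (hg : ContMDiff (𝓡 n) 𝓘(ℝ, V) ∞ g) (L : V →L[ℝ] W) (x : M)
    (w : TangentSpace (𝓡 n) x) :
    mfderiv (𝓡 n) 𝓘(ℝ, W) (L ∘ g) x w = L (mfderiv (𝓡 n) 𝓘(ℝ, V) g x w) := by
  rw [mfderiv_comp x L.differentiableAt.mdifferentiableAt (hg.mdifferentiableAt (by simp)),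
    ContinuousLinearMap.mfderiv_eq]
  rfl

omit [IsManifold (𝓡 n) ∞ M] [T2Space M] in
/-- Composition with a linear map whose kernel avoids secants and tangents. -/
theorem IsEmbeddingOn.clm_comp {g : M → V} {K : Set M} (hg : IsEmbeddingOn (n := n) g K)
    (L : V →L[ℝ] W) (h1 : ∀ x ∈ K, ∀ y ∈ K, L (g x - g y) = 0 → g x = g y)
    (h2 : ∀ x ∈ K, ∀ w, L (mfderiv (𝓡 n) 𝓘(ℝ, V) g x w) = 0 →
      mfderiv (𝓡 n) 𝓘(ℝ, V) g x w = 0) :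
    IsEmbeddingOn (n := n) (L ∘ g) K where
  contMDiff := L.contDiff.contMDiff.comp hg.contMDiff
  injOn x hx y hy hxy := hg.injOn hx hy (h1 x hx y hy (by
    rw [map_sub, sub_eq_zero]; exact hxy))
  injective_mfderiv x hx v w hvw := by
    rw [mfderiv_clm_comp hg.contMDiff, mfderiv_clm_comp hg.contMDiff] at hvw
    have h := h2 x hx (v - w) (by
      rw [map_sub]
      exact (map_sub L _ _).trans (sub_eq_zero.2 hvw))
    rw [map_sub, sub_eq_zero] at h
    exact hg.injective_mfderiv x hx h

/-- At `x` the bump with index `f.ind x` equals 1 nearby, so the corresponding component is the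
chart itself, which is immersive. The extra component `f i` forces a point with the same image to
lie in that same chart. -/
theorem isEmbeddingOn_pi {ι : Type*} [Fintype ι] {K : Set M}
    (f : SmoothBumpCovering ι (𝓡 n) M K) :
    IsEmbeddingOn (n := n) (fun x i => (f i x • extChartAt (𝓡 n) (f.c i) x, f i x)) K where
  contMDiff := contMDiff_pi_space.2 fun i =>
    ((f i).contMDiff_smul contMDiffOn_extChartAt).prodMk_space (f i).contMDiff
  injOn x hx y _ h := by
    obtain ⟨h₁, h₂⟩ := Prod.mk_inj.1 (congrFun h (f.ind x hx))
    rw [f.apply_ind x hx] at h₂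
    rw [← h₂, f.apply_ind x hx, one_smul, one_smul] at h₁
    exact (extChartAt (𝓡 n) (f.c _)).injOn (f.mem_extChartAt_ind_source x hx)
      (f.mem_extChartAt_source_of_eq_one h₂.symm) h₁
  injective_mfderiv x hx := by
    set g : M → ι → RSpace n × ℝ := fun x i => (f i x • extChartAt (𝓡 n) (f.c i) x, f i x)
    have hg : ContMDiff (𝓡 n) 𝓘(ℝ, ι → RSpace n × ℝ) ∞ g := contMDiff_pi_space.2 fun i =>
      ((f i).contMDiff_smul contMDiffOn_extChartAt).prodMk_space (f i).contMDiff
    let L : (ι → RSpace n × ℝ) →L[ℝ] RSpace n :=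
      (ContinuousLinearMap.fst ℝ (RSpace n) ℝ).comp
        (ContinuousLinearMap.proj (R := ℝ) (φ := fun _ : ι => RSpace n × ℝ) (f.ind x hx))
    have hL : mfderiv (𝓡 n) (𝓡 n) (L ∘ g) x =
        mfderiv (𝓡 n) (𝓡 n) (chartAt (RSpace n) (f.c (f.ind x hx))) x := by
      refine EventuallyEq.mfderiv_eq ((f.eventuallyEq_one x hx).mono fun y hy => ?_)
      change f (f.ind x hx) y • extChartAt (𝓡 n) (f.c (f.ind x hx)) y = _
      rw [hy, Pi.one_apply, one_smul]
      rfl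
    have hL' : ∀ v, (mfderiv (𝓡 n) (𝓡 n) (L ∘ g) x v : RSpace n) =
        mfderiv (𝓡 n) (𝓡 n) (chartAt (RSpace n) (f.c (f.ind x hx))) x v := fun v => by
      rw [← hL]
      rfl
    have hker := (mdifferentiable_chart (I := 𝓡 n) (f.c (f.ind x hx))).ker_mfderiv_eq_bot
      (f.mem_chartAt_ind_source x hx)
    have hinj := LinearMap.ker_eq_bot.1 hker
    intro v w hvw
    refine hinj ?_
    change mfderiv (𝓡 n) (𝓡 n) (chartAt (RSpace n) (f.c (f.ind x hx))) x v =
      mfderiv (𝓡 n) (𝓡 n) (chartAt (RSpace n) (f.c (f.ind x hx))) x w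
    refine ((hL' v).symm.trans ?_).trans (hL' w)
    rw [mfderiv_clm_comp hg, mfderiv_clm_comp hg, hvw]

open Module in
theorem exists_isEmbeddingOn [SigmaCompactSpace M] {K : Set M} (hK : IsCompact K) :
    ∃ (m : ℕ) (g : M → RSpace m), IsEmbeddingOn (n := n) g K := by
  obtain ⟨ι, f, -⟩ := SmoothBumpCovering.exists_isSubordinate (𝓡 n) hK.isClosed
    (U := fun _ => univ) fun x _ => univ_mem
  have hfin : Finite ι := by
    have := f.locallyFinite.finite_nonempty_inter_compact hK
    refine finite_univ_iff.1 (this.subset fun i _ => ⟨f.c i, ?_, f.c_mem' i⟩)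
    exact (f i).c_mem_support
  cases nonempty_fintype ι
  let e : (ι → RSpace n × ℝ) ≃L[ℝ] RSpace (finrank ℝ (ι → RSpace n × ℝ)) :=
    ContinuousLinearEquiv.ofFinrankEq finrank_euclideanSpace_fin.symm
  let L : (ι → RSpace n × ℝ) →L[ℝ] RSpace (finrank ℝ (ι → RSpace n × ℝ)) := e
  refine ⟨_, _, (isEmbeddingOn_pi f).clm_comp L (fun x _ y _ h => ?_)
    fun x _ w h => ?_⟩
  · exact sub_eq_zero.1 (e.map_eq_zero_iff.1 h)
  · exact e.map_eq_zero_iff.1 h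

/-! ### Generic projections -/

open Module in
theorem dimH_image_le_of_contDiffOn {A B : Type*} [NormedAddCommGroup A] [NormedSpace ℝ A]
    [FiniteDimensional ℝ A] [NormedAddCommGroup B] [NormedSpace ℝ B] {f : A → B} {S : Set A}
    (hS : IsOpen S) (hf : ContDiffOn ℝ 1 f S) : dimH (f '' S) ≤ finrank ℝ A := by
  refine (dimH_image_le_of_locally_lipschitzOn fun x hx => ?_).trans
    ((dimH_mono (subset_univ S)).trans_eq (Real.dimH_univ_eq_finrank A))
  obtain ⟨C, t, ht, hC⟩ := (hf.contDiffAt (hS.mem_nhds hx)).exists_lipschitzOnWith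
  exact ⟨C, t, mem_nhdsWithin_of_mem_nhds ht, hC⟩

omit [T2Space M] in
-- This places the tangent vectors at points of one chart in the image of a `C^1` map on a subset of
-- `ℝ^n × ℝ^n`, which bounds their Hausdorff dimension.
theorem mfderiv_eq_fderiv_chart {g : M → V} (hg : ContMDiff (𝓡 n) 𝓘(ℝ, V) ∞ g) {a x : M}
    (hx : x ∈ (chartAt (RSpace n) a).source) (w : TangentSpace (𝓡 n) x) :
    ∃ w' : RSpace n, mfderiv (𝓡 n) 𝓘(ℝ, V) g x w =
      fderiv ℝ (g ∘ (chartAt (RSpace n) a).symm) (chartAt (RSpace n) a x) w' := by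
  set e := chartAt (RSpace n) a
  have hs : ContMDiffOn (𝓡 n) 𝓘(ℝ, V) ∞ (g ∘ e.symm) e.target :=
    hg.comp_contMDiffOn contMDiffOn_chart_symm
  have h1 : MDifferentiableAt (𝓡 n) 𝓘(ℝ, V) (g ∘ e.symm) (e x) :=
    (hs.contMDiffAt (e.open_target.mem_nhds (e.map_source hx))).mdifferentiableAt (by simp)
  have h2 : MDifferentiableAt (𝓡 n) (𝓡 n) e x :=
    (contMDiffOn_chart (n := ∞).contMDiffAt (e.open_source.mem_nhds hx)).mdifferentiableAt (by simp)
  have heq : g =ᶠ[𝓝 x] (g ∘ e.symm) ∘ e := by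
    filter_upwards [e.open_source.mem_nhds hx] with y hy
    exact congrArg g (e.left_inv hy).symm
  refine ⟨mfderiv (𝓡 n) (𝓡 n) e x w, ?_⟩
  rw [heq.mfderiv_eq, mfderiv_comp x h1 h2, mfderiv_eq_fderiv]
  rfl

omit [T2Space M] in
/-- The secants and tangents of a compact subset have dimension at most `2 n + 1`. -/
theorem exists_secant_tangent_subset {g : M → V} (hg : ContMDiff (𝓡 n) 𝓘(ℝ, V) ∞ g) {K : Set M}
    (hK : IsCompact K) : ∃ B : Set V, dimH B ≤ (2 * n + 1 : ℕ) ∧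
      (∀ x ∈ K, ∀ y ∈ K, ∀ t : ℝ, t • (g x - g y) ∈ B) ∧
      ∀ x ∈ K, ∀ w, mfderiv (𝓡 n) 𝓘(ℝ, V) g x w ∈ B := by
  let e : M → OpenPartialHomeomorph M (RSpace n) := fun a => chartAt (RSpace n) a
  obtain ⟨F, -, hF⟩ := hK.elim_nhds_subcover (fun a => (e a).source)
    fun a _ => (e a).open_source.mem_nhds (mem_chart_source _ a)
  have hcov : ∀ x ∈ K, ∃ a ∈ F, x ∈ (e a).source := fun x hx => by simpa using hF hx
  have hs : ∀ a, ContDiffOn ℝ ∞ (g ∘ (e a).symm) (e a).target := fun a =>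
    contMDiffOn_iff_contDiffOn.1 (hg.comp_contMDiffOn contMDiffOn_chart_symm)
  -- The scalar factor makes the secants scale invariant; two points and one scalar give `2n + 1`
  -- parameters.
  let S₁ : M → M → Set V := fun a b =>
    (fun p : (RSpace n × RSpace n) × ℝ =>
      p.2 • ((g ∘ (e a).symm) p.1.1 - (g ∘ (e b).symm) p.1.2)) ''
      (((e a).target ×ˢ (e b).target) ×ˢ univ)
  let S₂ : M → Set V := fun a =>
    (fun p : RSpace n × RSpace n => fderiv ℝ (g ∘ (e a).symm) p.1 p.2) '' ((e a).target ×ˢ univ)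
  have h₁ : ∀ a b, dimH (S₁ a b) ≤ (2 * n + 1 : ℕ) := by
    intro a b
    refine (dimH_image_le_of_contDiffOn
      (((e a).open_target.prod (e b).open_target).prod isOpen_univ) ?_).trans_eq ?_
    · have ha : ContDiffOn ℝ ∞ (fun p : (RSpace n × RSpace n) × ℝ => (g ∘ (e a).symm) p.1.1)
          (((e a).target ×ˢ (e b).target) ×ˢ univ) :=
        (hs a).comp (contDiff_fst.comp contDiff_fst).contDiffOn fun p hp => hp.1.1
      have hb : ContDiffOn ℝ ∞ (fun p : (RSpace n × RSpace n) × ℝ => (g ∘ (e b).symm) p.1.2)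
          (((e a).target ×ˢ (e b).target) ×ˢ univ) :=
        (hs b).comp (contDiff_snd.comp contDiff_fst).contDiffOn fun p hp => hp.1.2
      exact (contDiff_snd.contDiffOn.smul (ha.sub hb)).of_le (by simp)
    · congr 1
      simp
      ring
  have h₂ : ∀ a, dimH (S₂ a) ≤ (2 * n + 1 : ℕ) := by
    intro a
    refine (dimH_image_le_of_contDiffOn ((e a).open_target.prod isOpen_univ) ?_).trans ?_
    · have ha : ContDiffOn ℝ ∞ (fun p : RSpace n × RSpace n => fderiv ℝ (g ∘ (e a).symm) p.1)
          ((e a).target ×ˢ univ) :=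
        ((hs a).fderiv_of_isOpen (e a).open_target (by simp)).comp contDiff_fst.contDiffOn
          fun p hp => hp.1
      exact (ha.clm_apply contDiff_snd.contDiffOn).of_le (by simp)
    · refine Nat.cast_le.2 ?_
      simp
      omega
  refine ⟨(⋃ a ∈ (F : Set M), ⋃ b ∈ (F : Set M), S₁ a b) ∪ ⋃ a ∈ (F : Set M), S₂ a, ?_, ?_, ?_⟩
  · rw [dimH_union, dimH_bUnion F.countable_toSet, dimH_bUnion F.countable_toSet]
    refine max_le (iSup₂_le fun a _ => ?_) (iSup₂_le fun a _ => h₂ a)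
    rw [dimH_bUnion F.countable_toSet]
    exact iSup₂_le fun b _ => h₁ a b
  · intro x hx y hy t
    obtain ⟨a, ha, hxa⟩ := hcov x hx
    obtain ⟨b, hb, hyb⟩ := hcov y hy
    refine Or.inl (mem_biUnion ha (mem_biUnion hb ⟨((e a x, e b y), t),
      ⟨⟨(e a).map_source hxa, (e b).map_source hyb⟩, mem_univ _⟩, ?_⟩))
    simp only [Function.comp_apply, (e a).left_inv hxa, (e b).left_inv hyb]
  · intro x hx w
    obtain ⟨a, ha, hxa⟩ := hcov x hx
    obtain ⟨w', hw'⟩ := mfderiv_eq_fderiv_chart hg hxa w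
    exact Or.inr (mem_biUnion ha ⟨(e a x, w'), ⟨(e a).map_source hxa, mem_univ _⟩, hw'.symm⟩)

open Module in
omit [T2Space M] in
-- Secants and tangents fill a set of dimension at most `2n + 1 < m + 1`, so some `v ≠ 0` avoids it.
-- As that set contains all multiples of them, the whole line of `v` meets them only in 0, and
-- orthogonal projection along `v` preserves the embedding.
theorem IsEmbeddingOn.exists_projection {m : ℕ} {g : M → RSpace (m + 1)} {K : Set M}
    (hg : IsEmbeddingOn (n := n) g K) (hK : IsCompact K) (hm : 2 * n + 1 ≤ m) :
    ∃ g' : M → RSpace m, IsEmbeddingOn (n := n) g' K := by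
  obtain ⟨B, hB, h1, h2⟩ := exists_secant_tangent_subset hg.contMDiff hK
  have hd : Dense Bᶜ := dense_compl_of_dimH_lt_finrank (hB.trans_lt (Nat.cast_lt.2 (by
    rw [finrank_euclideanSpace_fin]; omega)))
  have : Nontrivial (RSpace (m + 1)) := inferInstance
  obtain ⟨v, hv0, hvB⟩ := hd.inter_open_nonempty {0}ᶜ isOpen_compl_singleton
    (exists_ne (0 : RSpace (m + 1)))
  have hv0 : v ≠ 0 := hv0
  have : Fact (finrank ℝ (RSpace (m + 1)) = m + 1) := ⟨finrank_euclideanSpace_fin⟩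
  let e : ((ℝ ∙ v)ᗮ : Submodule ℝ (RSpace (m + 1))) ≃L[ℝ] RSpace m :=
    ContinuousLinearEquiv.ofFinrankEq
      ((Submodule.finrank_orthogonal_span_singleton hv0).trans finrank_euclideanSpace_fin.symm)
  let L : RSpace (m + 1) →L[ℝ] RSpace m :=
    (e : _ →L[ℝ] RSpace m).comp ((ℝ ∙ v)ᗮ).orthogonalProjectionOnto
  have hL : ∀ w, L w = 0 → ∃ t : ℝ, t • v = w := by
    intro w hw
    have h0 : ((ℝ ∙ v)ᗮ).orthogonalProjectionOnto w = 0 := e.map_eq_zero_iff.1 hw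
    rw [Submodule.orthogonalProjectionOnto_eq_zero_iff, Submodule.orthogonal_orthogonal] at h0
    exact Submodule.mem_span_singleton.1 h0
  refine ⟨_, hg.clm_comp L (fun x hx y hy h => ?_) fun x hx w h => ?_⟩
  · obtain ⟨t, ht⟩ := hL _ h
    rcases eq_or_ne t 0 with rfl | ht0
    · rw [zero_smul] at ht
      exact sub_eq_zero.1 ht.symm
    · refine absurd (h1 x hx y hy t⁻¹) ?_
      rwa [← ht, smul_smul, inv_mul_cancel₀ ht0, one_smul]
  · obtain ⟨t, ht⟩ := hL _ h
    rcases eq_or_ne t 0 with rfl | ht0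
    · rw [zero_smul] at ht
      exact ht.symm
    · have h3 := h2 x hx (t⁻¹ • w)
      rw [map_smul] at h3
      have h4 : t⁻¹ • t • v ∈ B := by
        rw [ht]
        exact h3
      rw [smul_smul, inv_mul_cancel₀ ht0, one_smul] at h4
      exact absurd h4 hvB

open Module in
-- The target dimension must not depend on `K`, since infinitely many slabs are later embedded in
-- one space. The target is first padded to dimension `2n + 1 + m` and then projected down `m`
-- times.
theorem exists_isEmbeddingOn_uniform [SigmaCompactSpace M] {K : Set M} (hK : IsCompact K) :
    ∃ g : M → RSpace (2 * n + 1), IsEmbeddingOn (n := n) g K := by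
  obtain ⟨m, g, hg⟩ := exists_isEmbeddingOn (n := n) hK
  let e : (RSpace m × RSpace (2 * n + 1)) ≃L[ℝ] RSpace (2 * n + 1 + m) :=
    ContinuousLinearEquiv.ofFinrankEq (by simp [add_comm])
  let L : RSpace m →L[ℝ] RSpace (2 * n + 1 + m) := 
    (e : RSpace m × RSpace (2 * n + 1) →L[ℝ] RSpace (2 * n + 1 + m)).comp
      (.inl ℝ (RSpace m) (RSpace (2 * n + 1)))
  have hL : ∀ w, L w = 0 → w = 0 := fun w hw =>
    congrArg Prod.fst (e.map_eq_zero_iff.1 hw : (w, (0 : RSpace (2 * n + 1))) = 0)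
  have h := hg.clm_comp L (fun x _ y _ h => sub_eq_zero.1 (hL _ h)) fun x _ w h => hL _ h
  have key : ∀ k (g : M → RSpace (2 * n + 1 + k)), IsEmbeddingOn (n := n) g K →
      ∃ g : M → RSpace (2 * n + 1), IsEmbeddingOn (n := n) g K := by
    intro k
    induction k with
    | zero => exact fun g hg => ⟨g, hg⟩
    | succ k ih =>
      intro g hg
      obtain ⟨g', hg'⟩ := hg.exists_projection (m := 2 * n + 1 + k) hK (by omega)
      exact ih g' hg'
  exact key m _ h

end Manifold

section Gluing

variable {n : ℕ} {M : Type*} [TopologicalSpace M] [ChartedSpace (RSpace n) M]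
  [IsManifold (𝓡 n) ∞ M] [T2Space M]

/-! ### Gluing embeddings of slabs -/

theorem ball_contDiffBump_subset (k : ℤ) {t : ℝ} (ρ : ContDiffBump (1 / 2 : ℝ))
    (hρ : ρ.rOut = 7 / 8) (h : ρ (t - k) ≠ 0) : (k : ℝ) - 3 / 8 < t ∧ t < k + 11 / 8 := by
  have h1 : t - k ∈ Function.support ρ := h
  rw [ρ.support_eq, hρ, Metric.mem_ball, Real.dist_eq, abs_lt] at h1
  constructor <;> linarith [h1.1, h1.2]

/-- A smooth proper function `f` and a family of maps `φ k`, embedding the slabs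
`k - 1 ≤ f ≤ k + 2`, are glued to a proper injective immersion. -/
theorem exists_proper_injective_immersion [SigmaCompactSpace M] :
    ∃ (N : ℕ) (g : M → RSpace N), IsEmbeddingOn (n := n) g univ ∧ IsProperMap g := by
  obtain ⟨f, hf, hfK⟩ := exists_smooth_exhaustion (n := n) (M := M)
  have hK : ∀ k : ℤ, IsCompact {x | (k : ℝ) - 1 ≤ f x ∧ f x ≤ k + 2} := fun k =>
    (hfK (k + 2)).of_isClosed_subset
      ((isClosed_le continuous_const hf.continuous).inter
        (isClosed_le hf.continuous continuous_const)) fun x hx => hx.2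
  choose φ hφ using fun k : ℤ => exists_isEmbeddingOn_uniform (n := n) (hK k)
  -- Placed at `k`, the bump is 1 on `[k - 1/4, k + 5/4]`, a neighbourhood of `[k, k + 1]`, and is
  -- supported in `[k - 3/8, k + 11/8]`. The supports for `k` and `k + 2` are disjoint.
  let ρ : ContDiffBump (1 / 2 : ℝ) := ⟨3 / 4, 7 / 8, by norm_num, by norm_num⟩
  have hρs : ContDiff ℝ ∞ ρ := ρ.contDiff
  let term : ℤ → M → RSpace (2 * n + 1) := fun k x => ρ (f x - k) • φ k x
  have hterm : ∀ k, ContMDiff (𝓡 n) 𝓘(ℝ, RSpace (2 * n + 1)) ∞ (term k) := fun k =>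
    ContMDiff.smul ((hρs.comp (contDiff_id.sub contDiff_const)).contMDiff.comp hf) (hφ k).contMDiff
  have hsupp : ∀ k x, term k x ≠ 0 → (k : ℝ) - 3 / 8 < f x ∧ f x < k + 11 / 8 := fun k x h =>
    ball_contDiffBump_subset k ρ rfl fun h0 => h (by simp only [term, h0, zero_smul])
  -- Only indices of the parity of `s` are summed, so at most one term is nonzero at each point.
  let S : ℤ → M → RSpace (2 * n + 1) := fun s x => ∑ᶠ j : ℤ, term (2 * j + s) x
  have hSs : ∀ s, ContMDiff (𝓡 n) 𝓘(ℝ, RSpace (2 * n + 1)) ∞ (S s) := by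
    intro s
    refine contMDiff_finsum (fun j => hterm _) fun x => ?_
    refine ⟨{y | f x - 1 < f y ∧ f y < f x + 1},
      ((isOpen_lt continuous_const hf.continuous).inter
        (isOpen_lt hf.continuous continuous_const)).mem_nhds ⟨by simp, by simp⟩, ?_⟩
    refine (finite_Icc (⌊(f x - s) / 2⌋ - 3) (⌊(f x - s) / 2⌋ + 3)).subset ?_
    rintro j ⟨y, hy, hy1, hy2⟩
    obtain ⟨h1, h2⟩ := hsupp _ _ hy
    push_cast at h1 h2
    have h3 := Int.floor_le ((f x - s) / 2)
    have h4 := Int.lt_floor_add_one ((f x - s) / 2)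
    have h5 : ((⌊(f x - s) / 2⌋ - 3 : ℤ) : ℝ) ≤ j := by push_cast; linarith
    have h6 : (j : ℝ) ≤ ((⌊(f x - s) / 2⌋ + 3 : ℤ) : ℝ) := by push_cast; linarith
    exact ⟨Int.cast_le.1 h5, Int.cast_le.1 h6⟩
  have hS : ∀ s j x, ((2 * j + s : ℤ) : ℝ) - 1 / 4 ≤ f x → f x ≤ (2 * j + s : ℤ) + 5 / 4 →
      S s x = φ (2 * j + s) x := by
    intro s j x h1 h2
    have h3 : S s x = term (2 * j + s) x := by
      refine finsum_eq_single _ j fun j' hj' => ?_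
      by_contra h0
      obtain ⟨h4, h5⟩ := hsupp _ _ h0
      push_cast at h1 h2 h4 h5
      have h6 : (j' : ℝ) < ((j + 1 : ℤ) : ℝ) := by push_cast; linarith
      have h7 : ((j - 1 : ℤ) : ℝ) < j' := by push_cast; linarith
      have h6 := Int.cast_lt.1 h6
      have h7 := Int.cast_lt.1 h7
      omega
    have h4 : ρ (f x - (2 * j + s : ℤ)) = 1 := by
      refine ρ.one_of_mem_closedBall ?_
      rw [Metric.mem_closedBall, Real.dist_eq, abs_le]
      change -(3 / 4 : ℝ) ≤ _ ∧ _ ≤ (3 / 4 : ℝ)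
      constructor <;> linarith
    rw [h3]
    simp only [term, h4, one_smul]
  have hmod : ∀ x, ∃ s j : ℤ, (s = 0 ∨ s = 1) ∧ ((2 * j + s : ℤ) : ℝ) ≤ f x ∧
      f x < (2 * j + s : ℤ) + 1 := by
    intro x
    refine ⟨⌊f x⌋ % 2, ⌊f x⌋ / 2, by omega, ?_⟩
    have h : 2 * (⌊f x⌋ / 2) + ⌊f x⌋ % 2 = ⌊f x⌋ := by omega
    rw [h]
    exact ⟨Int.floor_le _, Int.lt_floor_add_one _⟩
  -- The component `f` makes the map proper and puts points with equal image in the same slab; there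
  -- `S 0` or `S 1` coincides with the embedding of that slab.
  let G : M → ℝ × RSpace (2 * n + 1) × RSpace (2 * n + 1) := fun x => (f x, S 0 x, S 1 x)
  have hG : ContMDiff (𝓡 n) 𝓘(ℝ, ℝ × RSpace (2 * n + 1) × RSpace (2 * n + 1)) ∞ G :=
    hf.prodMk_space ((hSs 0).prodMk_space (hSs 1))
  have hGS : ∀ s : ℤ, s = 0 ∨ s = 1 →
      ∃ L : (ℝ × RSpace (2 * n + 1) × RSpace (2 * n + 1)) →L[ℝ] RSpace (2 * n + 1),
        ∀ x, L (G x) = S s x := by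
    rintro s (rfl | rfl)
    · exact ⟨(ContinuousLinearMap.fst ℝ _ _).comp (ContinuousLinearMap.snd ℝ _ _), fun x => rfl⟩
    · exact ⟨(ContinuousLinearMap.snd ℝ _ _).comp (ContinuousLinearMap.snd ℝ _ _), fun x => rfl⟩
  have hGe : IsEmbeddingOn (n := n) G univ := by
    refine ⟨hG, fun x _ y _ hxy => ?_, fun x _ => ?_⟩
    · obtain ⟨s, j, hs, h1, h2⟩ := hmod x
      obtain ⟨L, hL⟩ := hGS s hs
      have hfxy : f x = f y := congrArg Prod.fst hxy
      have hSxy : S s x = S s y := by rw [← hL, ← hL, hxy]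
      rw [hS s j x (by linarith) (by linarith), hS s j y (by linarith) (by linarith)] at hSxy
      exact (hφ _).injOn ⟨by linarith, by linarith⟩ ⟨by linarith, by linarith⟩ hSxy
    · obtain ⟨s, j, hs, h1, h2⟩ := hmod x
      obtain ⟨L, hL⟩ := hGS s hs
      have heq : L ∘ G =ᶠ[𝓝 x] φ (2 * j + s) := by
        filter_upwards [(isOpen_lt continuous_const hf.continuous).mem_nhds
          (show ((2 * j + s : ℤ) : ℝ) - 1 / 4 < f x by linarith),
          (isOpen_lt hf.continuous continuous_const).mem_nhds
          (show f x < (2 * j + s : ℤ) + 5 / 4 by linarith)] with y hy1 hy2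
        exact (hL y).trans (hS s j y (le_of_lt hy1) (le_of_lt hy2))
      intro v w hvw
      have h' : ∀ v, mfderiv (𝓡 n) 𝓘(ℝ, RSpace (2 * n + 1)) (φ (2 * j + s)) x v =
          L (mfderiv (𝓡 n) 𝓘(ℝ, ℝ × RSpace (2 * n + 1) × RSpace (2 * n + 1)) G x v) := by
        intro v
        rw [← mfderiv_clm_comp hG, heq.mfderiv_eq]
        rfl
      refine (hφ (2 * j + s)).injective_mfderiv x ⟨by linarith, by linarith⟩ ?_
      rw [h', h', hvw]
  let e : (ℝ × RSpace (2 * n + 1) × RSpace (2 * n + 1)) ≃L[ℝ]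
      RSpace (1 + (2 * n + 1 + (2 * n + 1))) :=
    ContinuousLinearEquiv.ofFinrankEq (by simp)
  let L : (ℝ × RSpace (2 * n + 1) × RSpace (2 * n + 1)) →L[ℝ]
    RSpace (1 + (2 * n + 1 + (2 * n + 1))) := e
  have he := hGe.clm_comp L (fun x _ y _ h => sub_eq_zero.1 (e.map_eq_zero_iff.1 h))
    fun x _ w h => e.map_eq_zero_iff.1 h
  refine ⟨_, _, he, ?_⟩
  refine isProperMap_iff_isCompact_preimage.2 ⟨he.contMDiff.continuous, fun C hC => ?_⟩
  obtain ⟨a, ha⟩ := (hC.image (continuous_fst.comp e.symm.continuous)).bddAbove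
  refine (hfK a).of_isClosed_subset (hC.isClosed.preimage he.contMDiff.continuous) fun x hx => ?_
  have := ha (mem_image_of_mem _ hx)
  simpa [L, G] using this

end Gluing

/-! ### Immersions and the Whitney embedding theorem -/

section Whitney

open Module in
theorem exists_prod_equiv_of_injective {n N : ℕ} (D : RSpace n →L[ℝ] RSpace N)
    (hD : Function.Injective D) :
    ∃ A : (RSpace n × RSpace (N - n)) ≃L[ℝ] RSpace N, ∀ u, A (u, 0) = D u := by
  have hn : finrank ℝ D.range = n :=
    (LinearMap.finrank_range_of_inj (f := (D : RSpace n →ₗ[ℝ] RSpace N)) hD).trans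
      finrank_euclideanSpace_fin
  have hK := Submodule.finrank_add_finrank_orthogonal D.range
  rw [hn, finrank_euclideanSpace_fin] at hK
  let e : RSpace (N - n) ≃L[ℝ] D.rangeᗮ :=
    ContinuousLinearEquiv.ofFinrankEq (by rw [finrank_euclideanSpace_fin]; omega)
  let L : (RSpace n × RSpace (N - n)) →ₗ[ℝ] RSpace N :=
    LinearMap.coprod D (D.rangeᗮ.subtype ∘ₗ (e : RSpace (N - n) →ₗ[ℝ] D.rangeᗮ))
  have hL : Function.Injective L := by
    refine LinearMap.ker_eq_bot.1 (LinearMap.ker_eq_bot'.2 ?_)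
    rintro ⟨u, c⟩ h
    have h' : D u + (e c : RSpace N) = 0 := h
    have h1 : D u ∈ D.range ⊓ D.rangeᗮ := by
      refine ⟨⟨u, rfl⟩, ?_⟩
      rw [eq_neg_of_add_eq_zero_left h']
      exact neg_mem (e c).2
    rw [Submodule.inf_orthogonal_eq_bot, Submodule.mem_bot] at h1
    rw [h1, zero_add] at h'
    have h2 : u = 0 := hD (h1.trans (map_zero D).symm)
    have h3 : c = 0 := e.map_eq_zero_iff.1 (Subtype.ext h')
    rw [h2, h3]
    rfl
  refine ⟨(LinearMap.linearEquivOfInjective L hL ?_).toContinuousLinearEquiv, fun u => ?_⟩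
  · rw [finrank_prod]
    simp only [finrank_euclideanSpace_fin]
    omega
  · change D u + (e 0 : RSpace N) = D u
    rw [map_zero]
    exact add_zero _

variable {n : ℕ} {M : Type*} [TopologicalSpace M] [ChartedSpace (RSpace n) M]
  [IsManifold (𝓡 n) ∞ M]

/-- Complete the derivative to an isomorphism `A` of `ℝ^n × ℝ^(N-n)` with `ℝ^N`. By the inverse
function theorem `(u, c) ↦ g(e⁻¹ u) + A(0, c)` has a local inverse, and following it by `A` gives a
chart in which `g` is `u ↦ A(u, 0)`. The complement is the same at all points, so these local
statements make a global immersion. -/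
theorem isImmersionAtOfComplement_of_injective_mfderiv {N : ℕ} {g : M → RSpace N}
    (hg : ContMDiff (𝓡 n) (𝓡 N) ∞ g) {x : M}
    (hx : Function.Injective (mfderiv (𝓡 n) (𝓡 N) g x)) :
    Manifold.IsImmersionAtOfComplement (RSpace (N - n)) (𝓡 n) (𝓡 N) ∞ g x := by
  set e := chartAt (RSpace n) x with he
  have hs : ContDiffOn ℝ ∞ (g ∘ e.symm) e.target :=
    contMDiffOn_iff_contDiffOn.1 (hg.comp_contMDiffOn contMDiffOn_chart_symm)
  have hxe : x ∈ e.source := mem_chart_source _ x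
  have hD : DifferentiableAt ℝ (g ∘ e.symm) (e x) :=
    (hs.contDiffAt (e.open_target.mem_nhds (e.map_source hxe))).differentiableAt (by simp)
  have hmf : ∀ w : RSpace n, mfderiv (𝓡 n) (𝓡 N) g x w = fderiv ℝ (g ∘ e.symm) (e x) w := by
    intro w
    rw [(hg.mdifferentiableAt (by simp)).mfderiv, modelWithCornersSelf_coe, range_id,
      fderivWithin_univ]
    rfl
  obtain ⟨A, hA⟩ := exists_prod_equiv_of_injective (fderiv ℝ (g ∘ e.symm) (e x))
    fun v w h => hx (((hmf v).trans h).trans (hmf w).symm)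
  let h : RSpace n × RSpace (N - n) → RSpace N := fun p => (g ∘ e.symm) p.1 + A (0, p.2)
  have hh : ContDiffOn ℝ ∞ h (e.target ×ˢ univ) :=
    (hs.comp contDiff_fst.contDiffOn fun p hp => hp.1).add
      (A.contDiff.comp (contDiff_const.prodMk contDiff_snd)).contDiffOn
  have hh' : HasFDerivAt h (A : RSpace n × RSpace (N - n) →L[ℝ] RSpace N) (e x, 0) := by
    have h1 : HasFDerivAt (fun p : RSpace n × RSpace (N - n) => (g ∘ e.symm) p.1)
        ((fderiv ℝ (g ∘ e.symm) (e x)).comp (ContinuousLinearMap.fst ℝ _ _)) (e x, 0) :=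
      HasFDerivAt.comp (e x, (0 : RSpace (N - n))) (g := g ∘ e.symm) hD.hasFDerivAt hasFDerivAt_fst
    have h2 := ((A : RSpace n × RSpace (N - n) →L[ℝ] RSpace N).comp
      ((ContinuousLinearMap.inr ℝ _ _).comp
        (ContinuousLinearMap.snd ℝ (RSpace n) (RSpace (N - n))))).hasFDerivAt (x := (e x, 0))
    refine (h1.add h2).congr_fderiv (ContinuousLinearMap.ext fun p => ?_)
    change fderiv ℝ (g ∘ e.symm) (e x) p.1 + A (0, p.2) = A p
    rw [← hA, ← map_add, Prod.mk_add_mk, add_zero, zero_add]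
  obtain ⟨E, hE0, hES, hEh, hEs⟩ := exists_smooth_openPartialHomeomorph
    (e.open_target.prod isOpen_univ) hh ⟨e.map_source hxe, mem_univ _⟩ hh'
  have hEg : ∀ u, E (u, 0) = g (e.symm u) := fun u => by
    rw [hEh]
    change (g ∘ e.symm) u + A (0, 0) = _
    rw [show ((0, 0) : RSpace n × RSpace (N - n)) = 0 from rfl, map_zero, add_zero]
    rfl
  set c : OpenPartialHomeomorph (RSpace N) (RSpace N) := E.symm.transHomeomorph A.toHomeomorph
  have hc : c ∈ IsManifold.maximalAtlas (𝓡 N) ∞ (RSpace N) := by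
    refine (IsManifold.mem_maximalAtlas_iff_contMDiffOn _).2 ⟨?_, ?_⟩
    · exact contMDiffOn_iff_contDiffOn.2 (A.contDiff.comp_contDiffOn hEs)
    · refine contMDiffOn_iff_contDiffOn.2 ?_
      have h3 : ContDiffOn ℝ ∞ E E.source := hEh ▸ hh.mono hES
      exact h3.comp A.symm.contDiff.contDiffOn fun y hy => hy
  have hcont : Continuous fun u : RSpace n => (u, (0 : RSpace (N - n))) := by fun_prop
  set s : Set M := e.source ∩ e ⁻¹' ((fun u : RSpace n => (u, (0 : RSpace (N - n)))) ⁻¹' E.source)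
  have hso : IsOpen s := e.isOpen_inter_preimage (E.open_source.preimage hcont)
  have hgx : g x = E (e x, 0) := by rw [hEg, e.left_inv hxe]
  refine .mk_of_continuousAt hg.continuous.continuousAt A (e.restr s) c ?_ ?_ ?_ hc ?_
  · rw [e.restr_source, hso.interior_eq]
    exact ⟨hxe, hxe, hE0⟩
  · change g x ∈ E.target
    rw [hgx]
    exact E.map_source hE0
  · exact restr_mem_maximalAtlas (contDiffGroupoid ∞ (𝓡 n))
      (IsManifold.chart_mem_maximalAtlas x) hso
  · intro u hu
    have hu' : u ∈ (e.restr s).target := by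
      simpa [OpenPartialHomeomorph.extend_target] using hu
    have hu1 := (e.restr s).map_target hu'
    rw [e.restr_source, hso.interior_eq] at hu1
    have hu2 : (e.restr s) ((e.restr s).symm u) = u := (e.restr s).right_inv hu'
    have hu3 : (u, (0 : RSpace (N - n))) ∈ E.source := by
      have := hu1.2.2
      rw [← hu2]
      exact this
    change A (E.symm (g (e.symm u))) = A (u, 0)
    rw [← hEg, E.left_inv hu3]

end Whitney

/-- The Whitney embedding theorem. -/
theorem exists_properEmbedding (M : SmoothMfd) [ConnectedSpace M] :
    ∃ N, Nonempty (ProperEmbedding M N) := by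
  have : LocallyCompactSpace M := ChartedSpace.locallyCompactSpace (RSpace M.dim) M
  have : SigmaCompactSpace M := sigmaCompactSpace_of_connected M
  obtain ⟨N, g, hg, hp⟩ := exists_proper_injective_immersion (n := M.dim) (M := M)
  refine ⟨N, ⟨⟨g, ⟨?_, ?_⟩, hp⟩⟩⟩
  · exact Manifold.IsImmersionOfComplement.isImmersion fun x =>
      isImmersionAtOfComplement_of_injective_mfderiv hg.contMDiff
        (hg.injective_mfderiv x (mem_univ x))
  · exact (IsClosedEmbedding.of_continuous_injective_isClosedMap hp.continuous
      (injOn_univ.1 hg.injOn) hp.isClosedMap).isEmbedding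

/-! ### Components -/

namespace SmoothMfd

variable {M W Z : SmoothMfd}

theorem Smooth.contMDiff {f : M → W} (hf : Smooth f) : ContMDiff (𝓡 M.dim) (𝓡 W.dim) ∞ f := hf

theorem Smooth.continuous {f : M → W} (hf : Smooth f) : Continuous f := hf.contMDiff.continuous

theorem mk_componentIncl (M : SmoothMfd) (c : ConnectedComponents M) (x : M.component c) :
    ConnectedComponents.mk (M.componentIncl c x) = c :=
  (show M.componentOpens c from x).2

instance (M : SmoothMfd) (c : ConnectedComponents M) : ConnectedSpace (M.component c) := by
  obtain ⟨x, rfl⟩ := ConnectedComponents.surjective_coe c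
  refine isConnected_iff_connectedSpace.1 ?_
  change IsConnected ((ConnectedComponents.mk : M → ConnectedComponents M) ⁻¹' {_})
  rw [connectedComponents_preimage_singleton]
  exact isConnected_connectedComponent

/-- The restriction of a smooth map with values in a component. -/
noncomputable def codRestrict (g : M → W) (c : ConnectedComponents W)
    (hc : ∀ x, ConnectedComponents.mk (g x) = c) : M → W.component c :=
  fun x => (⟨g x, hc x⟩ : W.componentOpens c)

theorem Smooth.codRestrict {g : M → W} (hg : Smooth g) {c : ConnectedComponents W}
    (hc : ∀ x, ConnectedComponents.mk (g x) = c) : Smooth (codRestrict g c hc) := by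
  change ContMDiff (𝓡 M.dim) (𝓡 W.dim) ∞ (fun x => (⟨g x, hc x⟩ : W.componentOpens c))
  exact (ContMDiff.iff_comp_isImmersion (Manifold.IsImmersion.of_opens (W.componentOpens c))).2
    ⟨hg.continuous.subtype_mk hc, hg⟩

/-- The restriction of a map to components. -/
noncomputable def restrict (f : M → W) (hf : Smooth f) (c : ConnectedComponents M)
    (c' : ConnectedComponents W)
    (h : hf.continuous.connectedComponentsMap c = c') : M.component c → W.component c' :=
  codRestrict (f ∘ M.componentIncl c) c' fun x => by
    rw [← h]
    conv_rhs => rw [← M.mk_componentIncl c x]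
    rfl

theorem smooth_restrict (f : M → W) (hf : Smooth f) (c : ConnectedComponents M)
    (c' : ConnectedComponents W) (h : hf.continuous.connectedComponentsMap c = c') :
    Smooth (restrict f hf c c' h) :=
  Smooth.codRestrict (hf.comp (M.smooth_componentIncl c)) _

end SmoothMfd

instance (M : SmoothMfd) [ConnectedSpace M] : Subsingleton (ConnectedComponents M) :=
  ⟨fun a b => by
    obtain ⟨x, rfl⟩ := ConnectedComponents.surjective_coe a
    obtain ⟨y, rfl⟩ := ConnectedComponents.surjective_coe b
    rw [ConnectedComponents.coe_eq_coe, PreconnectedSpace.connectedComponent_eq_univ,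
      PreconnectedSpace.connectedComponent_eq_univ]⟩

/-! ### Extensions from proper submanifolds -/

namespace ProperEmbedding

variable {M : SmoothMfd} [Nonempty M] {N L : ℕ} (φ : ProperEmbedding M N)

/-- Since `F = f ∘ π` near `φ(M)`, the extension sends a whole neighbourhood into `range f`. This is
what lets `X(F)` carry the open set `{u | im u ⊆ V}` into a prescribed `X(ψ)`. -/
theorem exists_extension_nhds {f : M → RSpace L} (hf : ContMDiff (𝓡 M.dim) (𝓡 L) ∞ f) :
    ∃ F : RSpace N → RSpace L, ContDiff ℝ ∞ F ∧ (∀ x, F (φ x) = f x) ∧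
      ∃ V, IsOpen V ∧ range φ ⊆ V ∧ ∀ y ∈ V, F y ∈ range f := by
  have hcl := φ.isProper.isClosed_range
  obtain ⟨U, π, hU, hφU, hπ, hπφ⟩ := exists_smooth_retraction φ.isSmoothEmbedding hcl
  obtain ⟨F, hF, V, hV, hφV, -, hFV⟩ := exists_contDiff_extension hU hπ hcl hφU hf
  refine ⟨F, hF, fun x => ?_, V, hV, hφV, fun y hy => ⟨π y, (hFV y hy).symm⟩⟩
  exact (hFV _ (hφV (mem_range_self x))).trans (congrArg f (hπφ x))

theorem exists_extension {f : M → RSpace L} (hf : ContMDiff (𝓡 M.dim) (𝓡 L) ∞ f) :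
    ∃ F : RSpace N → RSpace L, ContDiff ℝ ∞ F ∧ ∀ x, F (φ x) = f x :=
  let ⟨F, hF, h, _⟩ := φ.exists_extension_nhds hf
  ⟨F, hF, h⟩

omit [Nonempty M] in
theorem contMDiff : ContMDiff (𝓡 M.dim) (𝓡 N) ∞ φ :=
  φ.isSmoothEmbedding.isImmersion.contMDiff

end ProperEmbedding

/-! ### The sub-M-polyfolds `X(φ)` -/

namespace ConstructionFunctor

variable (X : ConstructionFunctor.{u}) {M : SmoothMfd} {N : ℕ} (φ : ProperEmbedding M N)

theorem map_eq_self {F : RSpace N → RSpace N} (hF : ContDiff ℝ ∞ F) {u : X.obj N}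
    (h : ∀ y ∈ X.im u, F y = y) : X.map F hF u = u :=
  (X.map_congr F id hF contDiff_id u h).trans (X.map_id N u)

/-- Let `d` be smooth with zero set exactly `φ(M)`. Then `X(φ)` is the equalizer of `X(d • v)` and
`X(0)`: one inclusion is axiom 3, the other follows by comparing images with axiom 2. -/
theorem isClosed_over : IsClosed (X.over φ) := by
  obtain ⟨d, hd, hds, -⟩ := φ.isProper.isClosed_range.isOpen_compl.exists_contDiff_support_eq
    (n := ⊤)
  have hd0 : ∀ y, d y = 0 ↔ y ∈ range φ := fun y => by
    rw [← not_iff_not, ← Ne, ← Function.mem_support, hd]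
    rfl
  let v : RSpace 1 := EuclideanSpace.single 0 1
  have hv : v ≠ 0 := by simp [v]
  have hD : ContDiff ℝ ∞ fun y => d y • v := hds.smul contDiff_const
  have h0 : ContDiff ℝ ∞ fun _ : RSpace N => (0 : RSpace 1) := contDiff_const
  have heq : X.over φ = {u | X.map _ hD u = X.map _ h0 u} := by
    ext u
    refine ⟨fun hu => X.map_congr _ _ hD h0 u fun y hy => ?_, fun hu y hy => ?_⟩
    · change d y • v = 0
      rw [(hd0 y).2 (hu hy), zero_smul]
    · have h1 : d y • v ∈ X.im (X.map _ hD u) := by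
        rw [X.im_map]
        exact ⟨y, hy, rfl⟩
      rw [show X.map _ hD u = X.map _ h0 u from hu, X.im_map] at h1
      obtain ⟨z, -, hz⟩ := h1
      exact (hd0 y).1 ((smul_eq_zero.1 hz.symm).resolve_right hv)
  rw [heq]
  exact isClosed_eq (continuousOn_univ.1 (X.map_smooth _ hD).1)
    (continuousOn_univ.1 (X.map_smooth _ h0).1)

/-- Extend `φ` itself to `R`. Then `X(R)` maps `{u | im u ⊆ V}` into `X(φ)` by axiom 2 and fixes
`X(φ)` by axiom 3. -/
theorem exists_isLocalRetraction [Nonempty M] :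
    ∃ U r, X.over φ ⊆ U ∧ IsLocalRetraction (X.over φ) U r := by
  obtain ⟨R, hR, hRφ, V, hV, hφV, hRV⟩ := φ.exists_extension_nhds φ.contMDiff
  have hRR : ∀ y ∈ range φ, R y = y := by
    rintro _ ⟨x, rfl⟩
    exact hRφ x
  have hU := X.isOpen_im_subset V hV
  refine ⟨{u | X.im u ⊆ V}, X.map R hR, fun u hu => hu.trans hφV, hU,
    (X.map_smooth R hR).msmoothOn hU, fun u hu => X.map_eq_self hR ?_, ?_⟩
  · rw [X.im_map]
    rintro _ ⟨y, hy, rfl⟩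
    exact hRR _ (hRV y (hu hy))
  · refine Subset.antisymm ?_ ?_
    · rintro _ ⟨u, hu, rfl⟩
      have h : X.im (X.map R hR u) ⊆ range φ := by
        rw [X.im_map]
        rintro _ ⟨y, hy, rfl⟩
        exact hRV y (hu hy)
      exact ⟨h.trans hφV, h⟩
    · rintro u ⟨hu, hu'⟩
      exact ⟨u, hu, X.map_eq_self hR fun y hy => hRR y (hu' hy)⟩

theorem isSubMPolyfold_over [Nonempty M] : IsSubMPolyfold (X.over φ) := by
  obtain ⟨U, r, hU, hr⟩ := X.exists_isLocalRetraction φ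
  exact fun a ha => ⟨U, r, hU ha, hr⟩

/-- Later arguments use only these properties of the induced structure: an injective smooth
inclusion through which smoothness can be tested. -/
theorem exists_over_mPolyfold [Nonempty M] : ∃ (P : MPolyfold.{u}) (j : P → X.obj N),
    Function.Injective j ∧ range j = X.over φ ∧ MSmooth j ∧
      ∀ (Z : MPolyfold.{u}) (S : Set Z) (s : Z → P), MSmoothOn (j ∘ s) S → MSmoothOn s S := by
  obtain ⟨U, r, hU, hr⟩ := X.exists_isLocalRetraction φ
  exact ⟨hr.toMPolyfold hU (X.isClosed_over φ), hr.incl hU _, Subtype.val_injective,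
    Subtype.range_val, hr.msmooth_incl hU _,
    fun Z S s hs => hr.msmoothOn_codRestrict hU _ hs fun z _ => rfl⟩

end ConstructionFunctor

/-! ### The functor on connected manifolds -/

section Connected

/-- The dimension of the ambient space of the chosen embedding. -/
noncomputable def SmoothMfd.embDim (M : SmoothMfd) [ConnectedSpace M] : ℕ :=
  (exists_properEmbedding M).choose

/-- A chosen proper embedding of a connected manifold. -/
noncomputable def SmoothMfd.emb (M : SmoothMfd) [ConnectedSpace M] :
    ProperEmbedding M M.embDim :=
  (exists_properEmbedding M).choose_spec.some

namespace ConstructionFunctor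

variable (X : ConstructionFunctor.{u}) (M W Z : SmoothMfd) [ConnectedSpace M] [ConnectedSpace W]
  [ConnectedSpace Z]

/-- The M-polyfold of a connected manifold. -/
noncomputable def space : MPolyfold.{u} := (X.exists_over_mPolyfold M.emb).choose

/-- The inclusion of the M-polyfold of `M` into that of the ambient space of `M`. -/
noncomputable def incl : X.space M → X.obj M.embDim :=
  (X.exists_over_mPolyfold M.emb).choose_spec.choose

theorem incl_injective : Function.Injective (X.incl M) :=
  (X.exists_over_mPolyfold M.emb).choose_spec.choose_spec.1

theorem range_incl : range (X.incl M) = X.over M.emb :=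
  (X.exists_over_mPolyfold M.emb).choose_spec.choose_spec.2.1

theorem msmooth_incl : MSmooth (X.incl M) :=
  (X.exists_over_mPolyfold M.emb).choose_spec.choose_spec.2.2.1

variable {M W Z}

theorem msmoothOn_of_incl {P : MPolyfold.{u}} {S : Set P} {s : P → X.space M}
    (hs : MSmoothOn (X.incl M ∘ s) S) : MSmoothOn s S :=
  (X.exists_over_mPolyfold M.emb).choose_spec.choose_spec.2.2.2 P S s hs

theorem im_incl_subset (u : X.space M) : X.im (X.incl M u) ⊆ range M.emb :=
  (X.range_incl M ▸ mem_range_self u :)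

theorem exists_incl_eq {u : X.obj M.embDim} (hu : X.im u ⊆ range M.emb) : ∃ v, X.incl M v = u :=
  (X.range_incl M ▸ hu : u ∈ range (X.incl M))

variable {N L : ℕ}

/-- The map induced by a smooth map `M → ℝ^N`. -/
noncomputable def push (g : M → RSpace N) (hg : ContMDiff (𝓡 M.dim) (𝓡 N) ∞ g) :
    X.space M → X.obj N :=
  X.map _ (M.emb.exists_extension hg).choose_spec.1 ∘ X.incl M

theorem msmooth_push (g : M → RSpace N) (hg : ContMDiff (𝓡 M.dim) (𝓡 N) ∞ g) :
    MSmooth (X.push g hg) :=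
  (X.map_smooth _ _).comp (X.msmooth_incl M)

/-- Axiom 3 makes the choice of extension irrelevant, because the images of points of `X.space M`
lie in the embedded `M`. Functoriality rests on this independence. -/
theorem push_eq {g : M → RSpace N} (hg : ContMDiff (𝓡 M.dim) (𝓡 N) ∞ g)
    {F : RSpace M.embDim → RSpace N} (hF : ContDiff ℝ ∞ F) (h : ∀ x, F (M.emb x) = g x)
    (u : X.space M) : X.push g hg u = X.map F hF (X.incl M u) := by
  refine X.map_congr _ _ _ hF _ fun y hy => ?_
  obtain ⟨x, rfl⟩ := X.im_incl_subset u hy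
  rw [h, (M.emb.exists_extension hg).choose_spec.2]

theorem map_push {g : M → RSpace N} (hg : ContMDiff (𝓡 M.dim) (𝓡 N) ∞ g)
    {H : RSpace N → RSpace L} (hH : ContDiff ℝ ∞ H) {k : M → RSpace L}
    (hk : ContMDiff (𝓡 M.dim) (𝓡 L) ∞ k) (h : ∀ x, H (g x) = k x) (u : X.space M) :
    X.map H hH (X.push g hg u) = X.push k hk u := by
  obtain ⟨F, hF, hFg⟩ := M.emb.exists_extension hg
  rw [X.push_eq hg hF hFg, X.push_eq hk (hH.comp hF) (fun x => ?_), X.map_comp]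
  rw [Function.comp_apply, hFg, h]

theorem push_emb (u : X.space M) : X.push M.emb M.emb.contMDiff u = X.incl M u := by
  rw [X.push_eq M.emb.contMDiff contDiff_id (fun _ => rfl), X.map_id]

theorem im_push_subset {g : M → RSpace N} (hg : ContMDiff (𝓡 M.dim) (𝓡 N) ∞ g) (u : X.space M) :
    X.im (X.push g hg u) ⊆ range g := by
  obtain ⟨F, hF, hFg⟩ := M.emb.exists_extension hg
  rw [X.push_eq hg hF hFg, X.im_map]
  rintro _ ⟨y, hy, rfl⟩
  obtain ⟨x, rfl⟩ := X.im_incl_subset u hy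
  exact ⟨x, (hFg x).symm⟩

theorem exists_incl_eq_push (f : M → W) (hf : SmoothMfd.Smooth f) (u : X.space M) :
    ∃ v, X.incl W v = X.push (W.emb ∘ f) (W.emb.contMDiff.comp hf.contMDiff) u :=
  X.exists_incl_eq ((X.im_push_subset _ u).trans (range_comp_subset_range _ _))

/-- The map induced by a smooth map of connected manifolds. -/
noncomputable def spaceMap (f : M → W) (hf : SmoothMfd.Smooth f) (u : X.space M) : X.space W :=
  (X.exists_incl_eq_push f hf u).choose

theorem incl_spaceMap (f : M → W) (hf : SmoothMfd.Smooth f) (u : X.space M) :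
    X.incl W (X.spaceMap f hf u) = X.push (W.emb ∘ f) (W.emb.contMDiff.comp hf.contMDiff) u :=
  (X.exists_incl_eq_push f hf u).choose_spec

theorem msmooth_spaceMap (f : M → W) (hf : SmoothMfd.Smooth f) : MSmooth (X.spaceMap f hf) :=
  X.msmoothOn_of_incl ((X.msmooth_push _ (W.emb.contMDiff.comp hf.contMDiff)).congr fun u _ =>
    (X.incl_spaceMap f hf u).symm)

theorem push_spaceMap {f : M → W} (hf : SmoothMfd.Smooth f) {g : W → RSpace N}
    (hg : ContMDiff (𝓡 W.dim) (𝓡 N) ∞ g) {k : M → RSpace N}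
    (hk : ContMDiff (𝓡 M.dim) (𝓡 N) ∞ k) (h : ∀ x, g (f x) = k x) (u : X.space M) :
    X.push g hg (X.spaceMap f hf u) = X.push k hk u := by
  obtain ⟨F, hF, hFg⟩ := W.emb.exists_extension hg
  rw [X.push_eq hg hF hFg, X.incl_spaceMap, X.map_push _ hF hk]
  intro x
  rw [Function.comp_apply, hFg, h]

theorem spaceMap_eq_self {f : M → M} (hf : SmoothMfd.Smooth f) (h : ∀ x, f x = x)
    (u : X.space M) : X.spaceMap f hf u = u := by
  obtain rfl : f = id := funext h
  refine X.incl_injective M ?_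
  rw [X.incl_spaceMap]
  exact X.push_emb u

theorem spaceMap_spaceMap {f : M → W} (hf : SmoothMfd.Smooth f) {g : W → Z}
    (hg : SmoothMfd.Smooth g) {k : M → Z} (hk : SmoothMfd.Smooth k) (h : ∀ x, g (f x) = k x)
    (u : X.space M) : X.spaceMap g hg (X.spaceMap f hf u) = X.spaceMap k hk u := by
  refine X.incl_injective Z ?_
  rw [X.incl_spaceMap, X.incl_spaceMap]
  exact X.push_spaceMap hf _ _ (fun x => congrArg Z.emb (h x)) u

end ConstructionFunctor

end Connected

/-! ### Extension to disconnected manifolds -/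

theorem msmoothOn_empty {X : MPolyfold.{u}} {Y : MPolyfold.{v}} (f : X → Y) : MSmoothOn f ∅ :=
  ⟨continuousOn_empty f, fun c _ d _ => c.repSmooth_of_isEmpty d (empty_inter _)⟩

/-- A map defined on a summand of a disjoint union. -/
theorem exists_msmoothOn_sigma {ι : Type} {P : ι → MPolyfold.{u}} {Y : MPolyfold.{v}} (i : ι)
    {q : P i → Y} (hq : MSmooth q) (s : MPolyfold.sigma P → Y) :
    ∃ q' : MPolyfold.sigma P → Y, MSmoothOn q' (range (MPolyfold.sigmaMk i)) ∧
      ∀ p, q' (MPolyfold.sigmaMk i p) = q p := by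
  classical
  -- Values off the summand `i` are taken from `s`, as `Y` comes with no default point.
  let q' : MPolyfold.sigma P → Y := fun y => if h : y.1 = i then q (h ▸ y.2) else s y
  have hq' : ∀ p, q' (MPolyfold.sigmaMk i p) = q p := fun p => dif_pos rfl
  refine ⟨q', msmoothOn_sigma (isOpen_range_sigmaMk (σ := fun i => P i)) fun j => ?_, hq'⟩
  by_cases hij : i = j
  · subst hij
    rw [preimage_range]
    exact MSmoothOn.congr hq fun p _ => (hq' p).symm
  · have : MPolyfold.sigmaMk (P := P) j ⁻¹' range (MPolyfold.sigmaMk i) = ∅ := by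
      refine eq_empty_of_forall_notMem ?_
      rintro p ⟨p', hp⟩
      exact hij (congrArg Sigma.fst hp)
    rw [this]
    exact msmoothOn_empty _

namespace SmoothMfd

/-- A connected manifold is identified with its component. -/
noncomputable def toComponent (M : SmoothMfd) [ConnectedSpace M] (c : ConnectedComponents M) :
    M → M.component c :=
  codRestrict id c fun _ => Subsingleton.elim _ _

theorem smooth_toComponent (M : SmoothMfd) [ConnectedSpace M] (c : ConnectedComponents M) :
    Smooth (M.toComponent c) :=
  M.smooth_id.codRestrict _

end SmoothMfd

namespace ConstructionFunctor

variable (X : ConstructionFunctor.{u})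

/-- The M-polyfold `X(M)` of a smooth manifold. -/
noncomputable def extObj (M : SmoothMfd) : MPolyfold.{u} :=
  MPolyfold.sigma fun c : ConnectedComponents M => X.space (M.component c)

variable {M W Z : SmoothMfd}

/-- The inclusion of a summand of `X(M)`. -/
noncomputable def extMk (c : ConnectedComponents M) (u : X.space (M.component c)) : X.extObj M :=
  MPolyfold.sigmaMk (P := fun c : ConnectedComponents M => X.space (M.component c)) c u

theorem exists_extMk_eq (y : X.extObj M) : ∃ c u, X.extMk (M := M) c u = y := ⟨y.1, y.2, rfl⟩

theorem extMk_injective (c : ConnectedComponents M) : Function.Injective (X.extMk c) :=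
  sigma_mk_injective (β := fun c : ConnectedComponents M => X.space (M.component c))

theorem msmooth_extMk (c : ConnectedComponents M) : MSmooth (X.extMk c) :=
  msmooth_sigmaMk (P := fun c : ConnectedComponents M => X.space (M.component c)) c

theorem msmooth_of_extMk {Y : MPolyfold.{v}} {f : X.extObj M → Y}
    (h : ∀ c, MSmooth (f ∘ X.extMk c)) : MSmooth f :=
  msmoothOn_sigma isOpen_univ h

/-- The map `X(f)` of a smooth map of manifolds. -/
noncomputable def extMap (f : M → W) (hf : SmoothMfd.Smooth f) (y : X.extObj M) : X.extObj W :=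
  X.extMk _ (X.spaceMap (SmoothMfd.restrict f hf y.1 _ rfl) (SmoothMfd.smooth_restrict f hf _ _ rfl)
    y.2)

/-- Allowing any `c'` equal to the image component lets the identity and composition laws be checked
without transport along equalities of components. -/
theorem extMap_extMk (f : M → W) (hf : SmoothMfd.Smooth f) {c : ConnectedComponents M}
    {c' : ConnectedComponents W} (h : hf.continuous.connectedComponentsMap c = c')
    (u : X.space (M.component c)) :
    X.extMap f hf (X.extMk c u) =
      X.extMk c' (X.spaceMap (SmoothMfd.restrict f hf c c' h)
        (SmoothMfd.smooth_restrict f hf c c' h) u) := by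
  subst h
  rfl

/-- The extension of a construction functor to manifolds. -/
noncomputable def ext : ManifoldFunctor.{u} where
  obj := X.extObj
  map f hf := X.extMap f hf
  map_smooth f hf := X.msmooth_of_extMk fun c =>
    (X.msmooth_extMk _).comp (X.msmooth_spaceMap _ (SmoothMfd.smooth_restrict f hf c _ rfl))
  map_id M y := by
    obtain ⟨c, u, rfl⟩ := X.exists_extMk_eq y
    have hc : M.smooth_id.continuous.connectedComponentsMap c = c := by
      obtain ⟨x, rfl⟩ := ConnectedComponents.surjective_coe c
      rfl
    rw [X.extMap_extMk id M.smooth_id hc]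
    exact congrArg _ (X.spaceMap_eq_self (SmoothMfd.smooth_restrict id M.smooth_id c c hc)
      (fun x => rfl) u)
  map_comp {M W Z} g f hg hf y := by
    obtain ⟨c, u, rfl⟩ := X.exists_extMk_eq y
    have hc : (hg.comp hf).continuous.connectedComponentsMap c =
        hg.continuous.connectedComponentsMap
          (hf.continuous.connectedComponentsMap c) := by
      obtain ⟨x, rfl⟩ := ConnectedComponents.surjective_coe c
      rfl
    rw [X.extMap_extMk _ (hg.comp hf) hc, X.extMap_extMk f hf rfl, X.extMap_extMk g hg rfl]
    exact congrArg _ (X.spaceMap_spaceMap (SmoothMfd.smooth_restrict f hf _ _ rfl)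
      (SmoothMfd.smooth_restrict g hg _ _ rfl) (SmoothMfd.smooth_restrict _ (hg.comp hf) c _ hc)
      (fun x => rfl) u).symm

/-! ### The identification with `X(φ)` -/

section Sharp

variable {N L : ℕ} (φ : ProperEmbedding M N)

/-- The identification of `X(M)` with `X(φ)`. -/
noncomputable def sharp (y : X.extObj M) : X.obj N :=
  X.push (φ ∘ M.componentIncl y.1) (φ.contMDiff.comp (M.smooth_componentIncl y.1).contMDiff) y.2

theorem sharp_extMk (c : ConnectedComponents M) (u : X.space (M.component c)) :
    X.sharp φ (X.extMk c u) =
      X.push (φ ∘ M.componentIncl c) (φ.contMDiff.comp (M.smooth_componentIncl c).contMDiff) u :=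
  rfl

theorem msmooth_sharp : MSmooth (X.sharp φ) :=
  X.msmooth_of_extMk fun c =>
    X.msmooth_push _ (φ.contMDiff.comp (M.smooth_componentIncl c).contMDiff)

theorem sharp_extMap (ψ : ProperEmbedding W L) {f : M → W} (hf : SmoothMfd.Smooth f)
    {F : RSpace N → RSpace L} (hF : ContDiff ℝ ∞ F) (h : ∀ x, F (φ x) = ψ (f x))
    (y : X.extObj M) : X.sharp ψ (X.extMap f hf y) = X.map F hF (X.sharp φ y) := by
  obtain ⟨c, u, rfl⟩ := X.exists_extMk_eq y
  have hk := ψ.contMDiff.comp (hf.comp (M.smooth_componentIncl c)).contMDiff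
  rw [X.extMap_extMk f hf rfl, sharp_extMk, sharp_extMk]
  exact (X.push_spaceMap (SmoothMfd.smooth_restrict f hf c _ rfl) _ hk (fun x => rfl) u).trans
    (X.map_push (φ.contMDiff.comp (M.smooth_componentIncl c).contMDiff) hF hk
      (fun x => h _) u).symm

/-- Let `A` be the single component of `M`. Extending its chosen embedding from `φ(M)` to `G` gives
`X(G)`, which maps `{u | im u ⊆ V}` into `X(A.emb)`; lifted to `X.space A`, it is a smooth left
inverse of `sharp` near `X(φ)`. -/
theorem isScDiffeoOnto_sharp [ConnectedSpace M] : IsScDiffeoOnto (X.sharp φ) (X.over φ) := by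
  obtain ⟨x₀⟩ : Nonempty M := inferInstance
  set c₀ : ConnectedComponents M := ConnectedComponents.mk x₀
  set A := M.component c₀
  have hσ : ContMDiff (𝓡 M.dim) (𝓡 A.embDim) ∞ (A.emb ∘ M.toComponent c₀) :=
    A.emb.contMDiff.comp (M.smooth_toComponent c₀).contMDiff
  have hg := φ.contMDiff.comp (M.smooth_componentIncl c₀).contMDiff
  obtain ⟨G, hG, hGφ, V, hV, hφV, hGV⟩ := φ.exists_extension_nhds hσ
  have hT : IsOpen {u | X.im u ⊆ V} := X.isOpen_im_subset V hV
  have hex : ∀ u : X.obj N, X.im u ⊆ V → ∃ v, X.incl A v = X.map G hG u := fun u hu => by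
    refine X.exists_incl_eq ?_
    rw [X.im_map]
    rintro _ ⟨y, hy, rfl⟩
    exact range_comp_subset_range _ _ (hGV y (hu hy))
  have hsharp : ∀ v, X.im (X.sharp φ (X.extMk c₀ v)) ⊆ range φ := fun v =>
    (X.im_push_subset hg v).trans (range_comp_subset_range _ _)
  have hinv : ∀ v, X.map G hG (X.sharp φ (X.extMk c₀ v)) = X.incl A v := fun v => by
    rw [sharp_extMk]
    exact (X.map_push hg hG A.emb.contMDiff (fun x => hGφ _) v).trans (X.push_emb v)
  refine isScDiffeoOnto_of_leftInverse (T := {u | X.im u ⊆ V}) (X.msmooth_sharp φ) ?_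
    (fun u hu => hu.trans hφV) (X.isSubMPolyfold_over φ) ?_ fun s => ?_
  · refine Subset.antisymm ?_ fun u hu => ?_
    · rintro _ ⟨y, rfl⟩
      obtain ⟨c, v, rfl⟩ := X.exists_extMk_eq y
      obtain rfl : c = c₀ := Subsingleton.elim _ _
      exact hsharp v
    · obtain ⟨v, hv⟩ := hex u (hu.trans hφV)
      refine ⟨X.extMk c₀ v, ?_⟩
      obtain ⟨H, hH, hHg⟩ := A.emb.exists_extension hg
      rw [sharp_extMk, X.push_eq hg hH hHg, hv, ← X.map_comp]
      refine X.map_eq_self _ fun y hy => ?_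
      obtain ⟨x, rfl⟩ := hu hy
      rw [Function.comp_apply, hGφ]
      exact hHg _
  · intro y y' h
    obtain ⟨c, v, rfl⟩ := X.exists_extMk_eq y
    obtain ⟨c', v', rfl⟩ := X.exists_extMk_eq y'
    obtain rfl : c = c₀ := Subsingleton.elim _ _
    obtain rfl : c' = c₀ := Subsingleton.elim _ _
    refine congrArg _ (X.incl_injective _ ?_)
    rw [← hinv, h, hinv]
  -- Off the open set the value of `p` is irrelevant; `s u` only witnesses that `X.space A` has a
  -- point.
  · have hp : ∀ u : X.obj N, ∃ v, X.im u ⊆ V → X.incl A v = X.map G hG u := fun u => by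
      by_cases hu : X.im u ⊆ V
      · exact (hex u hu).imp fun v hv _ => hv
      · obtain ⟨c, v, -⟩ := X.exists_extMk_eq (s u)
        obtain rfl : c = c₀ := Subsingleton.elim _ _
        exact ⟨v, fun h => absurd h hu⟩
    choose p hp using hp
    have hps : MSmoothOn p {u | X.im u ⊆ V} := X.msmoothOn_of_incl
      (((X.map_smooth G hG).msmoothOn hT).congr fun u hu => (hp u hu).symm)
    refine ⟨X.extMk c₀ ∘ p, MSmoothOn.comp (X.msmooth_extMk c₀) hps hT (mapsTo_univ _ _),
      fun y => ?_⟩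
    obtain ⟨c, v, rfl⟩ := X.exists_extMk_eq y
    obtain rfl : c = c₀ := Subsingleton.elim _ _
    refine congrArg _ (X.incl_injective _ ?_)
    rw [hp _ ((hsharp v).trans hφV), hinv]

end Sharp

/-! ### Components -/

/-- The manifold `M.component c` has a component `c₁` of its own, which is a different type; `f` is
the inclusion identifying the two, with inverse `toComponent`. -/
theorem extMap_componentIncl_extMk (c : ConnectedComponents M)
    (c₁ : ConnectedComponents (M.component c)) :
    ∃ f : (M.component c).component c₁ → M.component c, ∃ hf : SmoothMfd.Smooth f,
      (∀ x, f x = (M.component c).componentIncl c₁ x) ∧ ∀ u,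
      X.extMap (M.componentIncl c) (M.smooth_componentIncl c) (X.extMk c₁ u) =
        X.extMk c (X.spaceMap f hf u) := by
  have h : (M.smooth_componentIncl c).continuous.connectedComponentsMap c₁ = c := by
    obtain ⟨x, rfl⟩ := ConnectedComponents.surjective_coe c₁
    exact M.mk_componentIncl c x
  exact ⟨_, _, fun x => rfl, X.extMap_extMk _ (M.smooth_componentIncl c) h⟩

theorem range_extMap_componentIncl (c : ConnectedComponents M) :
    range (X.extMap (M.componentIncl c) (M.smooth_componentIncl c)) = range (X.extMk c) := by
  refine Subset.antisymm ?_ ?_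
  · rintro _ ⟨y, rfl⟩
    obtain ⟨c₁, u, rfl⟩ := X.exists_extMk_eq y
    obtain ⟨f, hf, -, h⟩ := X.extMap_componentIncl_extMk c c₁
    exact ⟨_, (h u).symm⟩
  · rintro _ ⟨u, rfl⟩
    obtain ⟨x⟩ : Nonempty (M.component c) := inferInstance
    set c₁ : ConnectedComponents (M.component c) := ConnectedComponents.mk x
    obtain ⟨f, hf, hfx, h⟩ := X.extMap_componentIncl_extMk c c₁
    have hσ := (M.component c).smooth_toComponent c₁
    refine ⟨X.extMk _ (X.spaceMap _ hσ u), (h _).trans (congrArg _ ?_)⟩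
    exact (X.spaceMap_spaceMap hσ hf (SmoothMfd.smooth_id _) (fun x => hfx _) u).trans
      (X.spaceMap_eq_self (SmoothMfd.smooth_id _) (fun x => rfl) u)

theorem isOpen_range_extMk (c : ConnectedComponents M) : IsOpen (range (X.extMk c)) :=
  isOpen_range_sigmaMk (σ := fun c : ConnectedComponents M => X.space (M.component c))

theorem isScDiffeoOnto_extMap_componentIncl (c : ConnectedComponents M) :
    IsScDiffeoOnto (X.extMap (M.componentIncl c) (M.smooth_componentIncl c))
      (range (X.extMap (M.componentIncl c) (M.smooth_componentIncl c))) := by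
  have hr := X.range_extMap_componentIncl c
  obtain ⟨x⟩ : Nonempty (M.component c) := inferInstance
  set c₁ : ConnectedComponents (M.component c) := ConnectedComponents.mk x
  obtain ⟨f, hf, hfx, h⟩ := X.extMap_componentIncl_extMk c c₁
  have hinv : ∀ u, X.spaceMap _ ((M.component c).smooth_toComponent c₁) (X.spaceMap f hf u) = u :=
    fun u => (X.spaceMap_spaceMap hf ((M.component c).smooth_toComponent c₁)
      (SmoothMfd.smooth_id _) (fun x => congrArg _ (hfx x)) u).trans
      (X.spaceMap_eq_self (SmoothMfd.smooth_id _) (fun x => rfl) u)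
  refine isScDiffeoOnto_of_leftInverse (X.ext.map_smooth _ (M.smooth_componentIncl c)) rfl hr.le
    (isSubMPolyfold_of_isOpen (hr ▸ X.isOpen_range_extMk c)) ?_ fun s => ?_
  · intro y y' hy
    obtain ⟨c₂, u, rfl⟩ := X.exists_extMk_eq y
    obtain ⟨c₃, u', rfl⟩ := X.exists_extMk_eq y'
    obtain rfl : c₂ = c₁ := Subsingleton.elim _ _
    obtain rfl : c₃ = c₁ := Subsingleton.elim _ _
    rw [h, h] at hy
    rw [← hinv u, X.extMk_injective c hy, hinv]
  · obtain ⟨q, hq, hq'⟩ := exists_msmoothOn_sigma c ((X.msmooth_extMk c₁).comp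
      (X.msmooth_spaceMap _ ((M.component c).smooth_toComponent c₁))) s
    refine ⟨q, hq, fun y => ?_⟩
    obtain ⟨c₂, u, rfl⟩ := X.exists_extMk_eq y
    obtain rfl : c₂ = c₁ := Subsingleton.elim _ _
    rw [h]
    refine (hq' _).trans ?_
    exact congrArg _ (hinv u)

/-! ### Euclidean spaces -/

theorem over_id (N : ℕ) : X.over (ProperEmbedding.id N) = univ :=
  eq_univ_of_forall fun _ y _ => ⟨y, rfl⟩

theorem exists_sharp_id_eq (N : ℕ) (u : X.obj N) :
    ∃ y : X.extObj (SmoothMfd.euclidean N), X.sharp (ProperEmbedding.id N) y = u := by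
  have h := (X.isScDiffeoOnto_sharp (ProperEmbedding.id N)).range_eq
  rw [over_id] at h
  exact (h ▸ mem_univ u : u ∈ range _)

/-- The identification of `X(N)` with `X(ℝ^N)`. -/
noncomputable def toExt (N : ℕ) (u : X.obj N) : X.extObj (SmoothMfd.euclidean N) :=
  (X.exists_sharp_id_eq N u).choose

theorem sharp_toExt (N : ℕ) (u : X.obj N) :
    X.sharp (ProperEmbedding.id N) (X.toExt N u) = u :=
  (X.exists_sharp_id_eq N u).choose_spec

theorem sharp_id_injective (N : ℕ) : Function.Injective (X.sharp (ProperEmbedding.id N)) :=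
  (X.isScDiffeoOnto_sharp (ProperEmbedding.id N)).injective

/-- As `X(id)` is all of `X(N)`, the clause `smooth_inv` with `U = univ` and `r = id` makes the
section `toExt` of `sharp` smooth. -/
theorem isScDiffeo_toExt (N : ℕ) : IsScDiffeo (X.toExt N) := by
  refine ⟨?_, X.sharp (ProperEmbedding.id N), X.msmooth_sharp _, X.sharp_toExt N, fun y =>
    X.sharp_id_injective N (X.sharp_toExt N _)⟩
  refine (X.isScDiffeoOnto_sharp (ProperEmbedding.id N)).smooth_inv univ id ?_ _
    fun u _ => X.sharp_toExt N u
  exact ⟨isOpen_univ, msmooth_id _, fun _ _ => rfl, by rw [over_id, image_id, univ_inter]⟩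

end ConstructionFunctor
end Polyfold

open Polyfold

theorem mainTheorem8 (X : ConstructionFunctor.{u}) :
    ∃ (Y : ManifoldFunctor.{u})
      (sharp : ∀ (M : SmoothMfd) [ConnectedSpace M] (N : ℕ), ProperEmbedding M N →
        Y.obj M → X.obj N)
      (κ : ∀ N : ℕ, X.obj N → Y.obj (SmoothMfd.euclidean N)),
      -- `X(M)` is identified with `X(φ)`, for every proper embedding `φ` of a connected `M`
      (∀ (M : SmoothMfd) [ConnectedSpace M] (N : ℕ) (φ : ProperEmbedding M N),
        IsScDiffeoOnto (sharp M N φ) (X.over φ)) ∧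
      -- `X(f)[u, φ] = [X(F)(u), ψ]` whenever `F ∘ φ = ψ ∘ f`
      (∀ (M W : SmoothMfd) [ConnectedSpace M] [ConnectedSpace W] (N L : ℕ)
        (φ : ProperEmbedding M N) (ψ : ProperEmbedding W L)
        (f : M → W) (hf : SmoothMfd.Smooth f)
        (F : RSpace N → RSpace L) (hF : ContDiff ℝ ∞ F), (∀ x, F (φ x) = ψ (f x)) →
        ∀ y : Y.obj M, sharp W L ψ (Y.map f hf y) = X.map F hF (sharp M N φ y)) ∧
      -- `X(M)` is the disjoint union of the `X(M_c)`, over the connected components `M_c` of `M`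
      (∀ M : SmoothMfd,
        (∀ c, IsScDiffeoOnto (Y.map (M.componentIncl c) (M.smooth_componentIncl c))
            (range (Y.map (M.componentIncl c) (M.smooth_componentIncl c))) ∧
          IsOpen (range (Y.map (M.componentIncl c) (M.smooth_componentIncl c)))) ∧
        ∀ y : Y.obj M, ∃! c, y ∈ range (Y.map (M.componentIncl c) (M.smooth_componentIncl c))) ∧
      -- `κ` is a natural sc-diffeomorphism, `κ_N(u) = [u, id]`
      (∀ N, IsScDiffeo (κ N)) ∧
      (∀ (N : ℕ) (u : X.obj N),
        sharp (SmoothMfd.euclidean N) N (ProperEmbedding.id N) (κ N u) = u) ∧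
      (∀ (N L : ℕ) (f : RSpace N → RSpace L) (hf : ContDiff ℝ ∞ f) (u : X.obj N),
        κ L (X.map f hf u) = Y.map f (SmoothMfd.smooth_euclidean hf) (κ N u)) := by
  refine ⟨X.ext, fun M _ N φ => X.sharp φ, X.toExt, fun M _ N φ => X.isScDiffeoOnto_sharp φ,
    fun M W _ _ N L φ ψ f hf F hF h y => X.sharp_extMap φ ψ hf hF h y, fun M => ⟨fun c =>
      ⟨X.isScDiffeoOnto_extMap_componentIncl c, ?_⟩, fun y => ?_⟩, X.isScDiffeo_toExt,
    X.sharp_toExt, fun N L f hf u => ?_⟩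
  · exact (X.range_extMap_componentIncl c).symm ▸ X.isOpen_range_extMk c
  · obtain ⟨c, u, rfl⟩ := X.exists_extMk_eq y
    refine ⟨c, (X.range_extMap_componentIncl c).ge (mem_range_self u), fun c' hc' => ?_⟩
    obtain ⟨v, hv⟩ : X.extMk c u ∈ range (X.extMk c') :=
      (X.range_extMap_componentIncl c').le hc'
    exact congrArg Sigma.fst hv
  -- Naturality of `κ` is checked after applying the injective `sharp` of the identity, where it
  -- becomes `sharp_extMap` for `F = f`.
  · refine X.sharp_id_injective L ?_
    refine (X.sharp_toExt L _).trans ?_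
    refine Eq.trans ?_ (X.sharp_extMap (ProperEmbedding.id N) (ProperEmbedding.id L)
      (SmoothMfd.smooth_euclidean hf) hf (fun x => rfl) _).symm
    rw [X.sharp_toExt]
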